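/- **Setting.** Let $s\ge 1$, $T,L,\eta_{\max},\varepsilon>0$ and put $p^{\Diamond}=\eta_{\max}^2T$. Functions of $x$ are $2\pi$-periodic, $\Omega_x=(-\pi,\pi)$, with Fourier coefficients $\hat f(k)=\frac1{2\pi}\int_{-\pi}^{\pi}f(x)e^{-ikx}\,dx$ and norms $\|f\|_{H^s}^2=\sum_k(1+k^2)^s|\hat f(k)|^2$, $|f|_{H^1}^2=\sum_k k^2|\hat f(k)|^2$, $\|f\|_{L^2(\Omega_x)}=\|f\|_{H^0}$. For functions of $(x,p)$, $L^2$ norms over boxes are Lebesgue $L^2$ norms, and $\|F\|_{H^s\times H^1}^2=\sum_k(1+k^2)^s\|\hat F(k,\cdot)\|_{H^1(\mathbb R)}^2$, where $\hat F(k,p)$ is the Fourier coefficient in $x$. Let $u$ be a continuous $2\pi$-periodic weak solution of $\partial_tu=\partial_{xx}u$ on $[0,T]$, with $u_T=u(T,\cdot)$ and $u_0=u(0,\cdot)\in H^s$ (for instance, $u_T$ with compactly supported Fourier transform). Let $w$ be the continuous, $x$-periodic weak solution of the Schrödingerised equation $$\partial_tw=-\partial_{xxp}w\quad (x\in\Omega_x,\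 p\in\mathbb R,\ 0\le t\le T),\qquad w(T,x,p)=e^{-|p|}u_T(x),$$ and $\mathcal W$ the continuous solution of the same equation that is $2\pi L$-periodic in $p$ with $\mathcal W(T,x,p)=\mathcal G(p)u_T(x)$, where $\mathcal G$ is the $2\pi L$-periodic extension of $e^{-|p|}$ from $[-\pi L,\pi L)$. Write $w_0=w(0,\cdot,\cdot)$, $\mathcal W_0=\mathcal W(0,\cdot,\cdot)$. Assume that $\eta_{\max}$ resolves $u_0$ to the tolerance $\varepsilon$: $$\eta_{\max}\ge(\delta/\varepsilon)^{1/s},\qquad \delta=\Big(\sum_{|k|>\eta_{\max}}(1+k^2)^s|\hat u_0(k)|^2\Big)^{1/2}.$$ *Discretization.* Let $N,M$ be positive even integers, $\Delta p=2\pi L/N$, $\Delta x=2\pi/M$, with grids $p_i=-\pi L+i\Delta p$ $(0\le i<N)$ and $x_i=-\pi+i\Delta x$ $(0\le i<M)$, frequencies $\mu_j=j-M/2$ and $\mu^p_j=(j-N/2)/L$, $D_x=\mathrm{diag}(\mu_j)$, $D_p=\mathrm{diag}(\mu^p_j)$, $A=D_x^2$, and $\Phi_{px}=\big(e^{i\mu^p_j(p_i+\pi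 L)}\big)_{ij}\otimes\big(e^{i\mu_j(x_i+\pi)}\big)_{ij}$. Let $\boldsymbol w_h$ solve $\frac{d}{dt}\boldsymbol w_h=i\Phi_{px}(D_p\otimes A)\Phi_{px}^{-1}\boldsymbol w_h$ on $[0,T]$ with $\boldsymbol w_h(T)=\big(e^{-|p_i|}u_T(x_{i'})\big)_{(i,i')}$. Put $$w_h^d(x,p)=\sum_{j,l}\big(\Phi_{px}^{-1}\boldsymbol w_h(0)\big)_{(j,l)}\,e^{i\mu^p_j(p+\pi L)}e^{i\mu_l(x+\pi)},\qquad u_h^d=e^pw_h^d .$$ **Theorem.** For all $s\ge1$ and $K\ge0$ there is a constant $C>0$, depending only on $s$ and $K$, such that in the above setting: 1. $\|w_0\|_{H^s\times H^1}<\infty$. 2. If $\pi L>3\eta_{\max}^2T$, then $$\int_0^T|\mathcal W(t,\cdot,-\pi L)-w(t,\cdot,-\pi L)|_{H^1(\Omega_x)}^2\,dt\le\tfrac52e^{-2(\pi L-3\eta_{\max}^2T)}\|u_T\|_{L^2(\Omega_x)}^2+e^{-3\eta_{\max}^2T}\varepsilon^2,$$ $$\|w_0-\mathcal W_0\|_{L^2(\Omega_x\times(-\pi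 L,\pi L))}\le C\Big(e^{-(\pi L-3\eta_{\max}^2T)}\|u_T\|_{L^2(\Omega_x)}+e^{-\frac32\eta_{\max}^2T}\varepsilon\Big).$$ 3. If $e^{-(\pi L-4.5\,\eta_{\max}^2T)}\|u_T\|_{L^2(\Omega_x)}\le K\varepsilon$, then for every $\mathcal M\le\min\{\pi L-\eta_{\max}^2T,\ \tfrac12\eta_{\max}^2T\}$, with $\tilde\Omega_p=(p^{\Diamond},p^{\Diamond}+\mathcal M)$, $$\|u_0-u_h^d\|_{L^2(\Omega_x\times\tilde\Omega_p)}\le C\Big((\Delta p+\Delta x^s)\,e^{\eta_{\max}^2T+\mathcal M}\|w_0\|_{H^s\times H^1}+(1+\sqrt{\mathcal M})\,\varepsilon\Big)$$ (for $\mathcal M\le 0$ the interval is empty, the left side is $0$ and $\sqrt{\mathcal M}$ is read as $0$). If moreover $\hat u_0(k)=0$ for all $|k|>\eta_{\max}$, the factor $1+\sqrt{\mathcal M}$ can be replaced by $1$. -/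

import Mathlib

open Real Set MeasureTheory
open scoped ENNReal ContDiff Kronecker Matrix

noncomputable section

namespace BackwardHeat

/-! ### Function spaces

Functions of `x` are `2π`-periodic functions on `ℝ`, described by their Fourier coefficients
on `(-π, π)`. All norms take values in `[0, ∞]`, so no convention about divergent sums or
integrals is involved. -/

/-- The `k`-th Fourier coefficient `(1 / 2π) ∫_{-π}^{π} f(x) e^{-ikx} dx`. -/
def coeff (f : ℝ → ℂ) (k : ℤ) : ℂ :=
  fourierCoeffOn (neg_lt_self Real.pi_pos) f k

/-- The periodic Sobolev norm `(∑_k (1 + k²)^s |f̂(k)|²)^{1/2}`; `s = 0` is the `L²` norm. -/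
def sobolevNorm (s : ℝ) (f : ℝ → ℂ) : ℝ≥0∞ :=
  (∑' k : ℤ, ENNReal.ofReal ((1 + (k : ℝ) ^ 2) ^ s) * ‖coeff f k‖ₑ ^ 2) ^ (1 / 2 : ℝ)

/-- The high-frequency part `(∑_{|k| > η} (1 + k²)^s |f̂(k)|²)^{1/2}` of the Sobolev norm. -/
def tailNorm (s η : ℝ) (f : ℝ → ℂ) : ℝ≥0∞ :=
  (∑' k : {k : ℤ // η < |(k : ℝ)|},
    ENNReal.ofReal ((1 + (k.1 : ℝ) ^ 2) ^ s) * ‖coeff f k.1‖ₑ ^ 2) ^ (1 / 2 : ℝ)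

/-- The square of the `H¹` seminorm, `∑_k k² |f̂(k)|²`. -/
def seminormH1Sq (f : ℝ → ℂ) : ℝ≥0∞ :=
  ∑' k : ℤ, ENNReal.ofReal ((k : ℝ) ^ 2) * ‖coeff f k‖ₑ ^ 2

/-- `g` is the weak derivative of `f` on the real line. -/
def IsWeakDeriv (f g : ℝ → ℂ) : Prop :=
  LocallyIntegrable f ∧ LocallyIntegrable g ∧
    ∀ φ : ℝ → ℂ, ContDiff ℝ ∞ φ → HasCompactSupport φ →
      ∫ p, f p * deriv φ p = - ∫ p, g p * φ p

/-- The square of the `H¹(ℝ)` norm; it is `∞` when there is no weak derivative (the weak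
derivative is unique up to null sets, so the infimum is over a single value). -/
def lineH1NormSq (f : ℝ → ℂ) : ℝ≥0∞ :=
  (∫⁻ p, ‖f p‖ₑ ^ 2) + ⨅ (g : ℝ → ℂ) (_ : IsWeakDeriv f g), ∫⁻ p, ‖g p‖ₑ ^ 2

/-- The norm of `H^s` in the periodic variable `x` with values in `H¹(ℝ)` in the variable `p`:
`(∑_k (1 + k²)^s ‖F̂(k, ·)‖²_{H¹(ℝ)})^{1/2}`. -/
def mixedNorm (s : ℝ) (F : ℝ → ℝ → ℂ) : ℝ≥0∞ :=
  (∑' k : ℤ, ENNReal.ofReal ((1 + (k : ℝ) ^ 2) ^ s) *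
    lineH1NormSq (fun p => coeff (fun x => F x p) k)) ^ (1 / 2 : ℝ)

/-- The `L²` norm of a function of `(x, p)` over `(-π, π) × (a, b)`. -/
def boxL2Norm (a b : ℝ) (F : ℝ → ℝ → ℂ) : ℝ≥0∞ :=
  eLpNorm (fun q : ℝ × ℝ => F q.1 q.2) 2 (volume.restrict (Ioo (-π) π ×ˢ Ioo a b))

/-! ### The equations -/

/-- `u` is a continuous, `2π`-periodic (in `x`) weak solution of the heat equation
`∂ₜ u = ∂ₓₓ u` on `[0, T]`. -/
structure IsHeatSolution (T : ℝ) (u : ℝ → ℝ → ℂ) : Prop where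
  continuousOn : ContinuousOn (fun q : ℝ × ℝ => u q.1 q.2) (Icc 0 T ×ˢ univ)
  periodic : ∀ t ∈ Icc 0 T, Function.Periodic (u t) (2 * π)
  weak : ∀ φ : ℝ → ℂ, ContDiff ℝ ∞ φ → Function.Periodic φ (2 * π) →
    ∀ t ∈ Icc 0 T,
      HasDerivWithinAt (fun τ => ∫ x in (-π)..π, u τ x * φ x)
        (∫ x in (-π)..π, u t x * iteratedDeriv 2 φ x) (Icc 0 T) t

/-- A test function: smooth, `2π`-periodic in `x`, compactly supported in `p`. -/
structure IsTest (φ : ℝ → ℝ → ℂ) : Prop where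
  contDiff : ContDiff ℝ ∞ (fun q : ℝ × ℝ => φ q.1 q.2)
  periodic : ∀ p, Function.Periodic (fun x => φ x p) (2 * π)
  compact : ∃ R : ℝ, ∀ x p, R < |p| → φ x p = 0

/-- `w` is a continuous, `2π`-periodic (in `x`) weak solution on `[0, T] × ℝ × ℝ` of the
Schrödingerised equation `∂ₜ w = -∂ₓₓₚ w` with data `w(T, x, p) = g(p) u_T(x)`. The three
integrations by parts turn `-∂ₓₓₚ` on `w` into `+∂ₓₓₚ` on the test function. -/
structure IsSchrodingerisedSolution (T : ℝ) (g : ℝ → ℝ) (uT : ℝ → ℂ)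
    (w : ℝ → ℝ → ℝ → ℂ) : Prop where
  continuousOn : ContinuousOn (fun q : ℝ × ℝ × ℝ => w q.1 q.2.1 q.2.2) (Icc 0 T ×ˢ univ)
  periodic : ∀ t ∈ Icc 0 T, ∀ p, Function.Periodic (fun x => w t x p) (2 * π)
  terminal : ∀ x p, w T x p = (g p : ℂ) * uT x
  weak : ∀ φ : ℝ → ℝ → ℂ, IsTest φ → ∀ t ∈ Icc 0 T,
    HasDerivWithinAt (fun τ => ∫ p, ∫ x in (-π)..π, w τ x p * φ x p)
      (∫ p, ∫ x in (-π)..π,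
        w t x p * deriv (fun p' => iteratedDeriv 2 (fun x' => φ x' p') x) p) (Icc 0 T) t

/-- The `2πL`-periodic extension of `e^{-|p|}` from `[-πL, πL)`:
`e^{-|p - 2mπL|}` for `(2m - 1)πL ≤ p < (2m + 1)πL`. -/
def periodicExp (L p : ℝ) : ℝ :=
  Real.exp (-|p - 2 * (⌊p / (2 * π * L) + 1 / 2⌋ : ℝ) * π * L|)

/-- `W` solves the periodic Schrödingerised problem on `(-π, π) × (-πL, πL)`; it is regarded
as a function on `ℝ × ℝ`, periodic in both variables. -/
structure IsPeriodicSolution (T L : ℝ) (uT : ℝ → ℂ) (W : ℝ → ℝ → ℝ → ℂ) : Prop where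
  solution : IsSchrodingerisedSolution T (periodicExp L) uT W
  periodic : ∀ t ∈ Icc 0 T, ∀ x, Function.Periodic (W t x) (2 * π * L)

/-! ### The Fourier spectral discretization

The box `(-π, π) × (-πL, πL)` carries `m` grid points in `x` and `n` grid points in `p`. -/

/-- The grid points `x_i = -π + i Δx`, `Δx = 2π / m`. -/
def gridX (m : ℕ) (i : Fin m) : ℝ := -π + (i : ℝ) * (2 * π / m)

/-- The grid points `p_i = -πL + i Δp`, `Δp = 2πL / n`. -/
def gridP (L : ℝ) (n : ℕ) (i : Fin n) : ℝ := -(π * L) + (i : ℝ) * (2 * π * L / n)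

/-- The frequencies `μ_j = j - m / 2` in `x`. -/
def freqX (m : ℕ) (j : Fin m) : ℝ := (j : ℝ) - (m : ℝ) / 2

/-- The frequencies `(j - n / 2) / L` in `p`. -/
def freqP (L : ℝ) (n : ℕ) (j : Fin n) : ℝ := ((j : ℝ) - (n : ℝ) / 2) / L

/-- The basis functions `e^{iμ_j (x + π)}`. -/
def basisX (m : ℕ) (j : Fin m) (x : ℝ) : ℂ :=
  Complex.exp (Complex.I * ((freqX m j * (x + π) : ℝ) : ℂ))

/-- The basis functions `e^{iμ_j (p + πL)}`. -/
def basisP (L : ℝ) (n : ℕ) (j : Fin n) (p : ℝ) : ℂ :=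
  Complex.exp (Complex.I * ((freqP L n j * (p + π * L) : ℝ) : ℂ))

/-- Values of the tensor basis at the grid points; rows are grid points `(p_i, x_{i'})`,
columns are modes. -/
def transform (L : ℝ) (n m : ℕ) : Matrix (Fin n × Fin m) (Fin n × Fin m) ℂ :=
  (Matrix.of fun i j => basisP L n j (gridP L n i)) ⊗ₖ
    (Matrix.of fun i j => basisX m j (gridX m i))

/-- The diagonal matrix `D_p ⊗ D_x²`. -/
def symbol (L : ℝ) (n m : ℕ) : Matrix (Fin n × Fin m) (Fin n × Fin m) ℂ :=
  (Matrix.diagonal fun j => (freqP L n j : ℂ)) ⊗ₖ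
    ((Matrix.diagonal fun j => (freqX m j : ℂ)) ^ 2)

/-- `wh` solves the semi-discrete system `d/dt w_h = i Φ (D_p ⊗ D_x²) Φ⁻¹ w_h` on `[0, T]`
with data `w_h(T) = g_h ⊗ u_h(T)`, the grid values of `e^{-|p|} u_T(x)`. -/
structure IsDiscreteSolution (T L : ℝ) (n m : ℕ) (uT : ℝ → ℂ)
    (wh : ℝ → Fin n × Fin m → ℂ) : Prop where
  terminal : ∀ i, wh T i = (Real.exp (-|gridP L n i.1|) : ℂ) * uT (gridX m i.2)
  ode : ∀ t ∈ Icc 0 T,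
    HasDerivWithinAt wh
      ((Complex.I • (transform L n m * symbol L n m * (transform L n m)⁻¹)) *ᵥ wh t)
      (Icc 0 T) t

/-- The trigonometric polynomial with mode coefficients `Φ⁻¹ v`. -/
def reconstruct (L : ℝ) (n m : ℕ) (v : Fin n × Fin m → ℂ) (x p : ℝ) : ℂ :=
  ∑ j : Fin n × Fin m,
    ((transform L n m)⁻¹ *ᵥ v) j * basisP L n j.1 p * basisX m j.2 x

end BackwardHeat

end

open BackwardHeat

/-!
In the Fourier coefficients with respect to `x` all equations are explicit. A continuous weak
solution of the heat equation satisfies `û(t, k) = e^{-k²t} û(0, k)`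
(`IsHeatSolution.coeff_eq`), and the Schrödingerised equation becomes the transport equation
`∂ₜ ŵ = k² ∂ₚ ŵ`, whose continuous weak solutions are constant along characteristics
(`transport_eq_terminal`). Hence `ŵ(0, k, p) = e^{-|p - k²T|} û(T, k)` on the line, and the same
formula with the periodised profile `G` holds for the periodic problem
(`IsSchrodingerisedSolution.coeff_eq`). Each norm in the theorem is then a sum over `k`, by
Parseval's identity, and each statement is an estimate for one scalar profile.

*Regularity.* The mixed norm of `w(0)` is comparable to the `H^s` norm of `u(T)`, as `e^{-|p|}`
belongs to `H¹(ℝ)`.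

*Periodisation.* Since `|G(p) - e^{-|p|}| ≤ e^{|p| - 2πL}`, with equality of `G` and `e^{-|p|}` for
`|p| ≤ πL`, the mode `k` contributes at most `½ e^{2k²T - 2πL} |û(T, k)|²`, both on the boundary
and in the box. For `|k| ≤ η` the exponent is at most `2η²T - 2πL`; for `|k| > η` the factor
`e^{2k²T}` is cancelled by the decay of `û(T, k)`, and the resolution condition bounds the sum of
`|û(0, k)|²` by `ε²` (`tsum_defect_le`).

*Discretization.* In the modal basis the semi-discrete system is diagonal, so that the computed
solution is the exact transport of the trigonometric interpolant of `G ⊗ u(T)`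
(`IsDiscreteSolution.coeff_reconstruct`). Transport preserves the `L²` norm over a period, so only
the interpolation error of the terminal data matters (`lintegral_mode_error_le`). It is bounded
through the aliasing formula `coeff_interp` and the Cauchy–Schwarz inequality
(`tsum_coeff_sub_interp_le`), at rate `Δx^s` for `u(T)` and at rate `Δp`, uniformly in `L`, for `G`.

The three contributions to `u(0) - e^p w_h`, namely recovery from the whole-line solution,
periodisation and discretization, are added mode by mode in `lintegral_mode_recovery_le`.
-/

namespace BackwardHeat

open Filter Topology

/-! ### Fourier coefficients on `(-π, π)` -/

/-- The trigonometric monomial `e^{ikx}`. -/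
noncomputable def expMode (k : ℤ) (x : ℝ) : ℂ :=
  Complex.exp (Complex.I * ((k * x : ℝ) : ℂ))

lemma expMode_add (k : ℤ) (x y : ℝ) : expMode k (x + y) = expMode k x * expMode k y := by
  simp only [expMode, ← Complex.exp_add]
  congr 1
  push_cast
  ring

lemma expMode_add_index (k l : ℤ) (x : ℝ) : expMode (k + l) x = expMode k x * expMode l x := by
  simp only [expMode, ← Complex.exp_add]
  congr 1
  push_cast
  ring

lemma norm_expMode (k : ℤ) (x : ℝ) : ‖expMode k x‖ = 1 := by
  rw [expMode, mul_comm, Complex.norm_exp_ofReal_mul_I]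

lemma expMode_two_pi (k : ℤ) : expMode k (2 * π) = 1 := by
  rw [expMode, Complex.exp_eq_one_iff]
  exact ⟨k, by push_cast; ring⟩

lemma expMode_periodic (k : ℤ) : Function.Periodic (expMode k) (2 * π) := fun x => by
  rw [expMode_add, expMode_two_pi, mul_one]

lemma expMode_contDiff (k : ℤ) : ContDiff ℝ ∞ (expMode k) := by
  unfold expMode
  exact (contDiff_const.mul
    (Complex.ofRealCLM.contDiff.comp (contDiff_const.mul contDiff_id))).cexp

@[fun_prop]
lemma expMode_continuous (k : ℤ) : Continuous (expMode k) := (expMode_contDiff k).continuous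

lemma hasDerivAt_expMode (k : ℤ) (x : ℝ) :
    HasDerivAt (expMode k) (Complex.I * k * expMode k x) x := by
  have h : HasDerivAt (fun y : ℝ => Complex.I * ((k * y : ℝ) : ℂ)) (Complex.I * k) x := by
    have := (((hasDerivAt_id x).const_mul (k : ℝ)).ofReal_comp).const_mul Complex.I
    simpa using this
  rw [mul_comm]
  exact h.cexp

lemma iteratedDeriv_two_expMode (k : ℤ) :
    iteratedDeriv 2 (expMode k) = fun x => -(k : ℂ) ^ 2 * expMode k x := by
  have h1 : deriv (expMode k) = fun x => Complex.I * k * expMode k x :=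
    funext fun x => (hasDerivAt_expMode k x).deriv
  rw [iteratedDeriv_succ, iteratedDeriv_one, h1]
  funext x
  rw [((hasDerivAt_expMode k x).const_mul (Complex.I * k)).deriv]
  linear_combination (k : ℂ) ^ 2 * expMode k x * Complex.I_sq

lemma fourier_eq_expMode (k : ℤ) (x : ℝ) :
    fourier k (x : AddCircle (π - -π)) = expMode k x := by
  rw [fourier_coe_apply, expMode]
  congr 1
  have : (π : ℂ) ≠ 0 := by exact_mod_cast Real.pi_ne_zero
  push_cast
  field_simp
  ring

lemma coeff_eq_integral (f : ℝ → ℂ) (k : ℤ) :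
    coeff f k = (2 * π : ℂ)⁻¹ * ∫ x in (-π)..π, f x * expMode (-k) x := by
  rw [coeff, fourierCoeffOn_eq_integral]
  simp only [fourier_eq_expMode, smul_eq_mul, Complex.real_smul]
  congr 1
  · push_cast
    ring
  · simp only [mul_comm]

lemma integral_mul_expMode (f : ℝ → ℂ) (k : ℤ) :
    ∫ x in (-π)..π, f x * expMode (-k) x = 2 * π * coeff f k := by
  have : (π : ℂ) ≠ 0 := by exact_mod_cast Real.pi_ne_zero
  rw [coeff_eq_integral]
  field_simp

lemma coeff_const_mul (c : ℂ) (f : ℝ → ℂ) (k : ℤ) :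
    coeff (fun x => c * f x) k = c * coeff f k :=
  fourierCoeffOn.const_mul _ _ _ _

lemma coeff_sub {f g : ℝ → ℂ} (hf : Continuous f) (hg : Continuous g) (k : ℤ) :
    coeff (fun x => f x - g x) k = coeff f k - coeff g k := by
  simp only [coeff_eq_integral, sub_mul]
  rw [intervalIntegral.integral_sub, mul_sub]
  · exact (hf.mul (expMode_continuous _)).intervalIntegrable _ _
  · exact (hg.mul (expMode_continuous _)).intervalIntegrable _ _

lemma coeff_finsetSum {ι : Type*} (s : Finset ι) (f : ι → ℝ → ℂ) (hf : ∀ i, Continuous (f i))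
    (k : ℤ) : coeff (fun x => ∑ i ∈ s, f i x) k = ∑ i ∈ s, coeff (f i) k := by
  simp only [coeff_eq_integral, Finset.sum_mul]
  rw [intervalIntegral.integral_finsetSum, Finset.mul_sum]
  exact fun i _ => ((hf i).mul (expMode_continuous _)).intervalIntegrable _ _

lemma continuous_coeff {X : Type*} [TopologicalSpace X] {f : X → ℝ → ℂ}
    (hf : Continuous f.uncurry) (k : ℤ) : Continuous fun t => coeff (f t) k := by
  simp only [coeff_eq_integral]
  have hf' : Continuous fun q : X × ℝ => f q.1 q.2 := hf
  refine continuous_const.mul ?_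
  refine intervalIntegral.continuous_parametric_intervalIntegral_of_continuous'
    (f := fun t x => f t x * expMode (-k) x) ?_ _ _
  exact hf'.mul ((expMode_continuous _).comp continuous_snd)

lemma coeff_expMode (k l : ℤ) : coeff (expMode k) l = if k = l then 1 else 0 := by
  have : Fact (0 < π - -π) := ⟨by linarith [Real.pi_pos]⟩
  have h : coeff (expMode k) l = fourierCoeff (fourier k : C(AddCircle (π - -π), ℂ)) l := by
    rw [fourierCoeff_eq_intervalIntegral _ _ (-π), coeff, fourierCoeffOn_eq_integral]
    simp only [fourier_eq_expMode]
    simp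
  rw [h, fourierCoeff_fourier, Pi.single_apply]
  simp only [eq_comm]

/-- Parseval's identity in `[0, ∞]`. -/
lemma lintegral_enorm_sq_eq_tsum {f : ℝ → ℂ} (hf : MemLp f 2 (volume.restrict (Ioc (-π) π))) :
    ∫⁻ x in Ioo (-π) π, ‖f x‖ₑ ^ 2 = ENNReal.ofReal (2 * π) * ∑' k : ℤ, ‖coeff f k‖ₑ ^ 2 := by
  have hpi := Real.pi_pos
  have h := hasSum_sq_fourierCoeffOn (neg_lt_self Real.pi_pos) hf
  have key : ∑' k : ℤ, ‖coeff f k‖ₑ ^ 2 =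
      ENNReal.ofReal ((π - -π)⁻¹ • ∫ x in (-π)..π, ‖f x‖ ^ 2) := by
    rw [← h.tsum_eq, ENNReal.ofReal_tsum_of_nonneg (fun _ => by positivity) h.summable]
    refine tsum_congr fun k => ?_
    rw [← ofReal_norm, ENNReal.ofReal_pow (norm_nonneg _)]
    rfl
  rw [key, smul_eq_mul, ← ENNReal.ofReal_mul (by positivity),
    intervalIntegral.integral_of_le (by linarith), restrict_Ioo_eq_restrict_Ioc,
    ← mul_assoc, show 2 * π * (π - -π)⁻¹ = 1 by field_simp; ring, one_mul,
    ofReal_integral_eq_lintegral_ofReal hf.norm.integrable_sq (ae_of_all _ fun _ => by positivity)]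
  refine lintegral_congr fun x => ?_
  rw [← ofReal_norm, ENNReal.ofReal_pow (norm_nonneg _)]

lemma memLp_two_Ioc_of_continuous {f : ℝ → ℂ} (hf : Continuous f) (a b : ℝ) :
    MemLp f 2 (volume.restrict (Ioc a b)) :=
  ((memLp_two_iff_integrable_sq_norm hf.aestronglyMeasurable).2
    ((hf.norm.pow 2).integrableOn_Ioc))

/-- The Fourier series of a continuous periodic function with summable coefficients converges
pointwise. -/
lemma hasSum_coeff_mul_expMode {f : ℝ → ℂ} (hf : Continuous f)
    (hp : Function.Periodic f (2 * π)) (hs : Summable (coeff f)) (x : ℝ) :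
    HasSum (fun k => coeff f k * expMode k x) (f x) := by
  have : Fact (0 < π - -π) := ⟨by linarith [Real.pi_pos]⟩
  have hp' : Function.Periodic f (π - -π) := by
    rw [show π - -π = 2 * π by ring]
    exact hp
  let F : C(AddCircle (π - -π), ℂ) := ⟨hp'.lift, continuous_coinduced_dom.mpr hf⟩
  have hF : ∀ y : ℝ, F y = f y := fun y => hp'.lift_coe y
  have hc : ∀ k, fourierCoeff F k = coeff f k := fun k => by
    rw [fourierCoeff_eq_intervalIntegral _ _ (-π), coeff, fourierCoeffOn_eq_integral]
    simp only [hF]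
    simp
  have := has_pointwise_sum_fourier_series_of_summable (f := F)
    (by rw [show fourierCoeff F = coeff f from funext hc]; exact hs) x
  simpa only [hc, hF, fourier_eq_expMode, smul_eq_mul] using this

/-- The `L²` norm over a box of a function continuous on the plane is computed from its Fourier
coefficients in `x`, by Parseval's identity on each line `p = const`. -/
lemma boxL2Norm_sq_eq_tsum (a b : ℝ) {F : ℝ → ℝ → ℂ} (hF : Continuous fun q : ℝ × ℝ => F q.1 q.2) :
    boxL2Norm a b F ^ 2 = ENNReal.ofReal (2 * π) *
      ∑' k : ℤ, ∫⁻ p in Ioo a b, ‖coeff (fun x => F x p) k‖ₑ ^ 2 := by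
  have hm : Measurable fun q : ℝ × ℝ => ‖F q.1 q.2‖ₑ ^ 2 :=
    (hF.measurable.enorm).pow_const 2
  have hcoeff : ∀ k : ℤ, Continuous fun p => coeff (fun x => F x p) k := fun k =>
    continuous_coeff (f := fun p x => F x p) (hF.comp continuous_swap) k
  have h1 : boxL2Norm a b F ^ 2 =
      ∫⁻ q in Ioo (-π) π ×ˢ Ioo a b, ‖F q.1 q.2‖ₑ ^ 2 := by
    rw [boxL2Norm, eLpNorm_eq_lintegral_rpow_enorm_toReal (by norm_num) (by norm_num)]
    rw [← ENNReal.rpow_natCast, ← ENNReal.rpow_mul]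
    norm_num
  rw [h1, Measure.volume_eq_prod, ← Measure.prod_restrict, lintegral_prod_symm' _ hm,
    ← lintegral_tsum (fun k => ((hcoeff k).measurable.enorm.pow_const 2).aemeasurable),
    ← lintegral_const_mul _ (Measurable.tsum fun k =>
      (hcoeff k).measurable.enorm.pow_const 2)]
  refine lintegral_congr fun p => ?_
  exact lintegral_enorm_sq_eq_tsum (memLp_two_Ioc_of_continuous (by fun_prop) _ _)

/-! ### Uniqueness for the heat equation and the transport equation -/

/-- Testing with `e^{-ikx}` turns the weak heat equation into an ODE for each Fourier
coefficient. -/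
lemma IsHeatSolution.coeff_eq {T : ℝ} {u : ℝ → ℝ → ℂ} (hu : IsHeatSolution T u) {t : ℝ}
    (ht : t ∈ Icc 0 T) (k : ℤ) :
    coeff (u t) k = Real.exp (-((k : ℝ) ^ 2 * t)) * coeff (u 0) k := by
  have hd : ∀ τ ∈ Icc 0 T, HasDerivWithinAt (fun τ => coeff (u τ) k)
      (-(k : ℂ) ^ 2 * coeff (u τ) k) (Icc 0 T) τ := by
    intro τ hτ
    have h := (hu.weak (expMode (-k)) (expMode_contDiff _) (expMode_periodic _) τ hτ).const_mul
      (2 * π : ℂ)⁻¹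
    simp only [← coeff_eq_integral] at h
    refine h.congr_deriv ?_
    rw [iteratedDeriv_two_expMode]
    simp only [mul_left_comm _ (-((-k : ℤ) : ℂ) ^ 2), intervalIntegral.integral_const_mul,
      ← coeff_eq_integral]
    push_cast
    ring
  have he : ∀ τ : ℝ, HasDerivAt (fun τ : ℝ => Complex.exp ((k : ℂ) ^ 2 * (τ : ℂ)))
      (Complex.exp ((k : ℂ) ^ 2 * (τ : ℂ)) * (k : ℂ) ^ 2) τ := by
    intro τ
    have := ((hasDerivAt_id τ).ofReal_comp.const_mul ((k : ℂ) ^ 2)).cexp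
    simpa using this
  have hg : ∀ τ ∈ Icc 0 T, HasDerivWithinAt
      (fun τ : ℝ => coeff (u τ) k * Complex.exp ((k : ℂ) ^ 2 * (τ : ℂ))) 0 (Icc 0 T) τ := by
    intro τ hτ
    refine ((hd τ hτ).mul (he τ).hasDerivWithinAt).congr_deriv ?_
    ring
  have hc := constant_of_derivWithin_zero (fun τ hτ => (hg τ hτ).differentiableWithinAt)
    (fun τ hτ => (hg τ (Ico_subset_Icc_self hτ)).derivWithin
      ((uniqueDiffOn_Icc (hτ.1.trans_lt hτ.2)) τ (Ico_subset_Icc_self hτ))) t ht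
  simp only [Complex.ofReal_zero, mul_zero, Complex.exp_zero, mul_one] at hc
  rw [← hc]
  push_cast
  rw [mul_left_comm, ← Complex.exp_add]
  simp

/-- Moving the test function against the flow of the transport equation `∂ₜ f = c ∂ₚ f`. -/
lemma integral_mul_comp_add (f : ℝ → ℂ) (ψ : ℝ → ℂ) (a : ℝ) :
    ∫ p, f p * ψ (p + a) = ∫ p, f (p - a) * ψ p := by
  rw [← integral_add_right_eq_self (fun p => f (p - a) * ψ p) a]
  simp

lemma continuous_integral_shift {f : ℝ → ℝ → ℂ} (hf : Continuous fun q : ℝ × ℝ => f q.1 q.2)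
    {ψ : ℝ → ℂ} (hψ : Continuous ψ) (hψc : HasCompactSupport ψ) (c : ℝ) :
    Continuous fun q : ℝ × ℝ => ∫ p, f q.1 p * ψ (p + c * q.2) := by
  have h : ∀ q : ℝ × ℝ, ∫ p, f q.1 p * ψ (p + c * q.2) =
      ∫ p in tsupport ψ, f q.1 (p - c * q.2) * ψ p := fun q => by
    rw [integral_mul_comp_add, setIntegral_eq_integral_of_forall_compl_eq_zero]
    intro p hp
    rw [image_eq_zero_of_notMem_tsupport hp, mul_zero]
  simp only [h]
  refine continuous_parametric_integral_of_continuous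
    (f := fun (q : ℝ × ℝ) p => f q.1 (p - c * q.2) * ψ p) ?_ hψc
  refine Continuous.mul ?_ (hψ.comp continuous_snd)
  exact hf.comp (f := fun r : (ℝ × ℝ) × ℝ => (r.1.1, r.2 - c * r.1.2)) (by fun_prop)

lemma hasDerivAt_integral_shift {f : ℝ → ℂ} (hf : Continuous f)
    {ψ : ℝ → ℂ} (hψ : ContDiff ℝ ∞ ψ) (hψc : HasCompactSupport ψ) (c σ : ℝ) :
    HasDerivAt (fun σ => ∫ p, f p * ψ (p + c * σ)) (c * ∫ p, f p * deriv ψ (p + c * σ)) σ := by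
  let g : ℝ → ℂ := fun y => ψ (-y)
  have hg : ContDiff ℝ 1 g := (hψ.comp contDiff_neg).of_le (by exact_mod_cast le_top)
  have hgc : HasCompactSupport g := hψc.comp_homeomorph (Homeomorph.neg ℝ)
  have hg' : ∀ y, deriv g y = -deriv ψ (-y) := fun y => deriv_comp_neg ψ y
  have h := hgc.hasDerivAt_convolution_right (ContinuousLinearMap.mul ℝ ℂ)
    (hf.locallyIntegrable (μ := volume)) hg (-(c * σ))
  have hin : HasDerivAt (fun σ : ℝ => -(c * σ)) (-c) σ := by
    exact ((hasDerivAt_id σ).const_mul c).neg.congr_deriv (by simp)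
  have h2 := h.scomp σ hin
  simp only [convolution, Function.comp_def, ContinuousLinearMap.mul_apply', hg', g] at h2
  refine (h2.congr_deriv ?_).congr_of_eventuallyEq (Eventually.of_forall fun σ => ?_)
  rotate_left
  · simp only
    congr 1
    funext p
    congr 2
    ring
  · simp only [mul_neg, integral_neg, Complex.real_smul]
    push_cast
    rw [neg_mul, neg_neg]
    congr 2
    funext p
    congr 2
    ring

/-- Continuous weak solutions of `∂ₜ f = c ∂ₚ f` are constant along characteristics. -/
lemma transport_eq_terminal {T c : ℝ} (hT : 0 < T) {f : ℝ → ℝ → ℂ}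
    (hf : Continuous fun q : ℝ × ℝ => f q.1 q.2)
    (hw : ∀ ψ : ℝ → ℂ, ContDiff ℝ ∞ ψ → HasCompactSupport ψ → ∀ t ∈ Ioo 0 T,
      HasDerivAt (fun τ => ∫ p, f τ p * ψ p) (-(c * ∫ p, f t p * deriv ψ p)) t)
    {t : ℝ} (ht : t ∈ Icc 0 T) (p : ℝ) : f t p = f T (p + c * (t - T)) := by
  have hconst : ∀ ψ : ℝ → ℂ, ContDiff ℝ ∞ ψ → HasCompactSupport ψ → ∀ t ∈ Icc 0 T,
      ∫ p, f t p * ψ (p + c * t) = ∫ p, f T p * ψ (p + c * T) := by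
    intro ψ hψ hψc
    have hψ' : ContDiff ℝ ∞ (deriv ψ) := ((contDiff_infty_iff_deriv).1 hψ).2
    let H : ℝ → ℝ → ℂ := fun τ σ => ∫ p, f τ p * ψ (p + c * σ)
    let J : ℝ → ℝ → ℂ := fun τ σ => c * ∫ p, f τ p * deriv ψ (p + c * σ)
    have hH : Continuous fun q : ℝ × ℝ => H q.1 q.2 :=
      continuous_integral_shift hf hψ.continuous hψc c
    have hJ : Continuous fun q : ℝ × ℝ => J q.1 q.2 :=
      continuous_const.mul (continuous_integral_shift hf hψ'.continuous hψc.deriv c)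
    have h1 : ∀ τ ∈ Ioo 0 T, ∀ σ, HasDerivAt (fun τ => H τ σ) (-J τ σ) τ := by
      intro τ hτ σ
      have := hw (fun p => ψ (p + c * σ)) (hψ.comp (contDiff_id.add contDiff_const))
        (hψc.comp_homeomorph (Homeomorph.addRight (c * σ))) τ hτ
      simpa only [deriv_comp_add_const] using this
    have h2 : ∀ τ σ, HasDerivAt (fun σ => H τ σ) (J τ σ) σ := fun τ σ =>
      hasDerivAt_integral_shift
        (hf.comp (f := fun p : ℝ => (τ, p)) (by fun_prop)) hψ hψc c σ
    have hd : ∀ τ ∈ Ioo 0 T, HasDerivAt (fun τ => H τ τ) 0 τ := by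
      intro τ hτ
      let L : ℂ → ℝ →L[ℝ] ℂ := fun z => ContinuousLinearMap.toSpanSingleton ℝ z
      have hL : Continuous L :=
        (ContinuousLinearMap.toSpanSingletonCLE (𝕜 := ℝ) (E := ℂ)).continuous
      have hs := hasStrictFDerivAt_uncurry_coprod (𝕜 := ℝ) (u := (τ, τ)) (f := H)
        (f₁ := fun τ σ => L (-J τ σ)) (f₂ := fun τ σ => L (J τ σ))
        (by
          filter_upwards [(isOpen_Ioo.prod isOpen_univ).mem_nhds
            (show ((τ, τ) : ℝ × ℝ) ∈ Ioo 0 T ×ˢ univ from ⟨hτ, trivial⟩)] with v hv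
          exact (h1 v.1 hv.1 v.2).hasFDerivAt)
        (Eventually.of_forall fun v => (h2 v.1 v.2).hasFDerivAt)
        (hL.comp hJ.neg).continuousAt (hL.comp hJ).continuousAt
      have := HasFDerivAt.comp_hasDerivAt (f := fun τ : ℝ => (τ, τ)) τ hs.hasFDerivAt
        ((hasDerivAt_id τ).prodMk (hasDerivAt_id τ))
      refine this.congr_deriv ?_
      simp [L, Function.HasUncurry.uncurry]
    have hcont : Continuous fun τ => H τ τ :=
      hH.comp (f := fun τ : ℝ => (τ, τ)) (by fun_prop)
    obtain ⟨z, hz⟩ := isOpen_Ioo.exists_is_const_of_deriv_eq_zero isPreconnected_Ioo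
      (fun τ hτ => (hd τ hτ).differentiableAt.differentiableWithinAt)
      (fun τ hτ => (hd τ hτ).deriv)
    have hcl : ∀ τ ∈ Icc 0 T, H τ τ = z := by
      rw [← closure_Ioo hT.ne]
      exact fun τ hτ => (Set.EqOn.closure (f := fun τ => H τ τ) (g := fun _ => z)
        hz hcont continuous_const) hτ
    intro t ht
    exact (hcl t ht).trans (hcl T ⟨hT.le, le_rfl⟩).symm
  have hft : Continuous fun p => f t (p - c * t) :=
    hf.comp (f := fun p : ℝ => (t, p - c * t)) (by fun_prop)
  have hfT : Continuous fun p => f T (p - c * T) :=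
    hf.comp (f := fun p : ℝ => (T, p - c * T)) (by fun_prop)
  have hae : ∀ᵐ p : ℝ, f t (p - c * t) = f T (p - c * T) := by
    refine ae_eq_of_integral_contDiff_smul_eq hft.locallyIntegrable hfT.locallyIntegrable ?_
    intro g hg hgc
    have h := hconst (fun p => (g p : ℂ)) (Complex.ofRealCLM.contDiff.comp hg)
      (hgc.comp_left (g := fun r : ℝ => (r : ℂ)) Complex.ofReal_zero) t ht
    have e1 := integral_mul_comp_add (f t) (fun p => (g p : ℂ)) (c * t)
    have e2 := integral_mul_comp_add (f T) (fun p => (g p : ℂ)) (c * T)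
    simp only [Complex.real_smul, mul_comm]
    simp only [mul_comm] at e1 e2 h
    exact e1.symm.trans (h.trans e2)
  have heq := Measure.eq_of_ae_eq hae hft hfT
  have : f t (p + c * t - c * t) = f T (p + c * t - c * T) := congrFun heq (p + c * t)
  rw [show p + c * t - c * t = p by ring, show p + c * t - c * T = p + c * (t - T) by ring] at this
  exact this

/-- The Fourier coefficients in `x` of a continuous weak solution of the Schrödingerised equation
are the terminal data transported with speed `k²`. -/
lemma IsSchrodingerisedSolution.coeff_eq {T : ℝ} (hT : 0 < T) {g : ℝ → ℝ} {uT : ℝ → ℂ}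
    {w : ℝ → ℝ → ℝ → ℂ} (hw : IsSchrodingerisedSolution T g uT w) {t : ℝ} (ht : t ∈ Icc 0 T)
    (p : ℝ) (k : ℤ) :
    coeff (fun x => w t x p) k = g (p + (k : ℝ) ^ 2 * (t - T)) * coeff uT k := by
  -- Extending `w` by constants in time makes it continuous everywhere.
  let cl : ℝ → ℝ := fun τ => (projIcc 0 T hT.le τ : ℝ)
  have hcl : ∀ τ ∈ Icc 0 T, cl τ = τ := fun τ hτ => congrArg Subtype.val (projIcc_of_mem hT.le hτ)
  have hclc : Continuous cl := continuous_subtype_val.comp continuous_projIcc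
  let f : ℝ → ℝ → ℂ := fun τ p => coeff (fun x => w (cl τ) x p) k
  have hf : Continuous fun q : ℝ × ℝ => f q.1 q.2 := by
    refine continuous_coeff (f := fun (q : ℝ × ℝ) x => w (cl q.1) x q.2) ?_ k
    refine hw.continuousOn.comp_continuous
      (f := fun r : (ℝ × ℝ) × ℝ => (cl r.1.1, r.2, r.1.2)) (by fun_prop) fun r => ?_
    exact ⟨(projIcc 0 T hT.le r.1.1).2, trivial⟩
  have hweak : ∀ ψ : ℝ → ℂ, ContDiff ℝ ∞ ψ → HasCompactSupport ψ → ∀ t ∈ Ioo 0 T,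
      HasDerivAt (fun τ => ∫ p, f τ p * ψ p)
        (-(((k : ℝ) ^ 2 : ℝ) * ∫ p, f t p * deriv ψ p)) t := by
    intro ψ hψ hψc t ht
    have hψd : ∀ p, DifferentiableAt ℝ ψ p := fun p =>
      (hψ.differentiable (by simp)).differentiableAt
    have htest : IsTest fun x p => expMode (-k) x * ψ p := by
      refine ⟨((expMode_contDiff _).comp contDiff_fst).mul (hψ.comp contDiff_snd), ?_, ?_⟩
      · intro p x
        simp only [expMode_periodic (-k) x]
      · obtain ⟨R, hR⟩ := hψc.isCompact.isBounded.exists_norm_le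
        refine ⟨R, fun x p hp => ?_⟩
        have h0 : ψ p = 0 := image_eq_zero_of_notMem_tsupport fun hmem => (hR p hmem).not_gt hp
        simp only [h0, mul_zero]
    have h := ((hw.weak _ htest t (Ioo_subset_Icc_self ht)).const_mul
      (2 * π : ℂ)⁻¹).hasDerivAt (Icc_mem_nhds ht.1 ht.2)
    have hin : ∀ (φ : ℝ → ℂ) τ p, ∫ x in (-π)..π, w τ x p * (expMode (-k) x * φ p) =
        2 * π * (coeff (fun x => w τ x p) k * φ p) := by
      intro φ τ p
      simp only [← mul_assoc, intervalIntegral.integral_mul_const]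
      rw [integral_mul_expMode]
    have hder : ∀ p x, deriv (fun p' => iteratedDeriv 2 (fun x' => expMode (-k) x' * ψ p') x) p =
        expMode (-k) x * (-(k : ℂ) ^ 2 * deriv ψ p) := by
      intro p x
      have : ∀ p', iteratedDeriv 2 (fun x' => expMode (-k) x' * ψ p') x =
          (-(k : ℂ) ^ 2 * expMode (-k) x) * ψ p' := by
        intro p'
        have := congrFun (iteratedDeriv_two_expMode (-k)) x
        rw [show (fun x' => expMode (-k) x' * ψ p') = fun x' => ψ p' * expMode (-k) x' from
          funext fun _ => mul_comm _ _, iteratedDeriv_const_mul_field, this]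
        push_cast
        ring
      simp only [this]
      rw [deriv_const_mul _ (hψd p)]
      ring
    have hpi : (2 * π : ℂ) ≠ 0 := by exact_mod_cast (mul_pos two_pos Real.pi_pos).ne'
    simp only [hder, hin ψ, hin fun p => -(k : ℂ) ^ 2 * deriv ψ p, integral_const_mul,
      inv_mul_cancel_left₀ hpi] at h
    refine (h.congr_deriv ?_).congr_of_eventuallyEq ?_
    · rw [← hcl t (Ioo_subset_Icc_self ht)]
      simp only [mul_left_comm _ (-(k : ℂ) ^ 2), integral_const_mul]
      push_cast
      simp only [f, hcl t (Ioo_subset_Icc_self ht)]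
      ring
    · filter_upwards [Icc_mem_nhds ht.1 ht.2] with τ hτ
      simp only [f, hcl τ hτ]
  have key := transport_eq_terminal hT hf hweak ht p
  simp only [f, hcl t ht, hcl T ⟨hT.le, le_rfl⟩, hw.terminal, coeff_const_mul] at key
  exact key

/-! ### The profile `e^{-|p|}` on the line -/

/-- The profile `e^{-b|p - a|}` has a right derivative everywhere, in spite of its kink. -/
lemma hasDerivWithinAt_exp_neg_abs (b a p : ℝ) :
    HasDerivWithinAt (fun p => Real.exp (-(b * |p - a|)))
      ((if p < a then b else -b) * Real.exp (-(b * |p - a|))) (Ioi p) p := by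
  by_cases hp : p < a
  · have h : HasDerivAt (fun p => Real.exp (b * (p - a))) (Real.exp (b * (p - a)) * b) p := by
      simpa using (((hasDerivAt_id p).sub_const a).const_mul b).exp
    have heq : (fun p => Real.exp (-(b * |p - a|))) =ᶠ[𝓝 p] fun p => Real.exp (b * (p - a)) := by
      filter_upwards [Iio_mem_nhds hp] with q hq
      rw [abs_of_neg (sub_neg.2 hq)]
      congr 1
      ring
    rw [if_pos hp, show Real.exp (-(b * |p - a|)) = Real.exp (b * (p - a)) from
      heq.self_of_nhds, mul_comm]
    exact (h.congr_of_eventuallyEq heq).hasDerivWithinAt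
  · have h : HasDerivAt (fun p => Real.exp (-(b * (p - a))))
        (Real.exp (-(b * (p - a))) * -b) p := by
      have := (((hasDerivAt_id p).sub_const a).const_mul b).neg.exp
      simpa using this
    have heq : ∀ q, p ≤ q → Real.exp (-(b * |q - a|)) = Real.exp (-(b * (q - a))) := by
      intro q hq
      rw [abs_of_nonneg (sub_nonneg.2 ((not_lt.1 hp).trans hq))]
    rw [if_neg hp, heq p le_rfl, mul_comm]
    exact h.hasDerivWithinAt.congr (fun q hq => heq q (le_of_lt hq)) (heq p le_rfl)

lemma lintegral_exp_neg_abs_sq (a : ℝ) :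
    ∫⁻ p, ENNReal.ofReal (Real.exp (-|p - a|)) ^ 2 = 1 := by
  have hint : ∫ p : ℝ, Real.exp (-2 * |p|) = 1 := by
    rw [integral_comp_abs (f := fun x => Real.exp (-2 * x)), integral_exp_mul_Ioi (by norm_num)]
    norm_num
  have hi : Integrable fun p : ℝ => Real.exp (-2 * |p|) :=
    Integrable.of_integral_ne_zero (by rw [hint]; exact one_ne_zero)
  rw [lintegral_sub_right_eq_self (fun p => ENNReal.ofReal (Real.exp (-|p|)) ^ 2) a]
  calc ∫⁻ p : ℝ, ENNReal.ofReal (Real.exp (-|p|)) ^ 2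
      = ∫⁻ p : ℝ, ENNReal.ofReal (Real.exp (-2 * |p|)) := by
        refine lintegral_congr fun p => ?_
        rw [← ENNReal.ofReal_pow (Real.exp_nonneg _), ← Real.exp_nat_mul]
        congr 2
        push_cast
        ring
    _ = 1 := by
        rw [← ofReal_integral_eq_lintegral_ofReal hi (ae_of_all _ fun _ => Real.exp_nonneg _),
          hint, ENNReal.ofReal_one]

lemma enorm_ofReal_mul_sq (r : ℝ) (c : ℂ) :
    ‖(r : ℂ) * c‖ₑ ^ 2 = ENNReal.ofReal (r ^ 2) * ‖c‖ₑ ^ 2 := by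
  rw [enorm_mul, mul_pow]
  congr 1
  rw [← ofReal_norm, Complex.norm_real, Real.norm_eq_abs, ← ENNReal.ofReal_pow (abs_nonneg _),
    sq_abs]

lemma lintegral_profile_sq (a : ℝ) (c : ℂ) :
    ∫⁻ p : ℝ, ‖((Real.exp (-|p - a|) : ℝ) : ℂ) * c‖ₑ ^ 2 = ‖c‖ₑ ^ 2 := by
  simp only [enorm_ofReal_mul_sq, ENNReal.ofReal_pow (Real.exp_nonneg _)]
  rw [lintegral_mul_const _ (by fun_prop), lintegral_exp_neg_abs_sq, one_mul]

/-- The weak derivative of `e^{-|p - a|}` is its right derivative. -/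
lemma isWeakDeriv_profile (a : ℝ) (c : ℂ) :
    IsWeakDeriv (fun p => ((Real.exp (-|p - a|) : ℝ) : ℂ) * c)
      (fun p => (if p < a then 1 else -1) * (((Real.exp (-|p - a|) : ℝ) : ℂ) * c)) := by
  have hf : Continuous fun p : ℝ => ((Real.exp (-|p - a|) : ℝ) : ℂ) * c := by fun_prop
  have hsm : Measurable fun p : ℝ => if p < a then (1 : ℂ) else -1 :=
    Measurable.ite measurableSet_Iio measurable_const measurable_const
  have hbd : ∀ p : ℝ, ‖if p < a then (1 : ℂ) else -1‖ = 1 := fun p => by split_ifs <;> simp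
  refine ⟨hf.locallyIntegrable, ?_, fun φ hφ hφc => ?_⟩
  · refine (hf.locallyIntegrable (μ := volume)).mono
      (hsm.mul hf.measurable).aestronglyMeasurable (ae_of_all _ fun p => ?_)
    rw [norm_mul, hbd, one_mul]
  · obtain ⟨R, hR⟩ := hφc.isCompact.isBounded.exists_norm_le
    have hz : ∀ p, R < |p| → φ p = 0 := fun p hp =>
      image_eq_zero_of_notMem_tsupport fun hmem => (hR p hmem).not_gt hp
    have hdz : ∀ p, R < |p| → deriv φ p = 0 := fun p hp =>
      image_eq_zero_of_notMem_tsupport fun hmem =>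
        (hR p (closure_minimal support_deriv_subset isClosed_closure hmem)).not_gt hp
    let S : ℝ := |R| + 1
    have hS : R < S := (le_abs_self R).trans_lt (lt_add_one _)
    have hS0 : 0 < S := by positivity
    have hsupp : ∀ h : ℝ → ℂ, (∀ p, R < |p| → h p = 0) → Function.support h ⊆ Ioc (-S) S := by
      intro h hh p hp
      by_contra hcon
      apply hp
      apply hh
      rw [lt_abs]
      by_contra! h'
      exact hcon ⟨by linarith, by linarith⟩
    have hi1 : IntervalIntegrable
        (fun p : ℝ => ((Real.exp (-|p - a|) : ℝ) : ℂ) * c * deriv φ p) volume (-S) S :=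
      (hf.mul (hφ.continuous_deriv (by simp))).intervalIntegrable _ _
    have hi2 : IntervalIntegrable (fun p : ℝ => (if p < a then (1 : ℂ) else -1) *
        (((Real.exp (-|p - a|) : ℝ) : ℂ) * c) * φ p) volume (-S) S := by
      refine ((hf.mul hφ.continuous).intervalIntegrable (-S) S).mono_fun
        ((hsm.mul hf.measurable).mul hφ.continuous.measurable).aestronglyMeasurable
        (ae_of_all _ fun p => ?_)
      simp only [norm_mul, hbd, one_mul, Pi.mul_apply, le_refl]
    rw [← intervalIntegral.integral_eq_integral_of_support_subset
        (hsupp _ fun p hp => by rw [hdz p hp, mul_zero]),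
      ← intervalIntegral.integral_eq_integral_of_support_subset
        (hsupp _ fun p hp => by rw [hz p hp, mul_zero]), eq_neg_iff_add_eq_zero,
      ← intervalIntegral.integral_add hi1 hi2,
      intervalIntegral.integral_eq_sub_of_hasDeriv_right
        (f := fun p => ((Real.exp (-|p - a|) : ℝ) : ℂ) * c * φ p)
        (hf.mul hφ.continuous).continuousOn ?_ (hi1.add hi2),
      hz S (by rwa [abs_of_pos hS0]), hz (-S) (by rwa [abs_neg, abs_of_pos hS0])]
    · simp
    · intro p _
      have h1 := (hasDerivWithinAt_exp_neg_abs 1 a p).ofReal_comp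
      simp only [one_mul] at h1
      have h2 : HasDerivWithinAt φ (deriv φ p) (Ioi p) p :=
        ((hφ.differentiable (by simp)) p).hasDerivAt.hasDerivWithinAt
      refine ((h1.mul_const c).mul h2).congr_deriv ?_
      split_ifs <;> push_cast <;> ring

lemma enorm_sq_le_lineH1NormSq (a : ℝ) (c : ℂ) :
    ‖c‖ₑ ^ 2 ≤ lineH1NormSq fun p => ((Real.exp (-|p - a|) : ℝ) : ℂ) * c := by
  rw [lineH1NormSq, lintegral_profile_sq]
  exact le_self_add

lemma lineH1NormSq_le (a : ℝ) (c : ℂ) :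
    lineH1NormSq (fun p => ((Real.exp (-|p - a|) : ℝ) : ℂ) * c) ≤ 2 * ‖c‖ₑ ^ 2 := by
  rw [lineH1NormSq, lintegral_profile_sq, two_mul]
  gcongr
  refine (iInf₂_le _ (isWeakDeriv_profile a c)).trans (le_of_eq ?_)
  rw [← lintegral_profile_sq a c]
  refine lintegral_congr fun p => ?_
  rw [enorm_mul]
  split_ifs <;> simp

/-! ### The periodised profile -/

/-- The periodised profile is `e^{-d}`, where `d` is the distance to the lattice `2πLℤ`. -/
lemma periodicExp_eq {L : ℝ} (hL : 0 < L) (p : ℝ) :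
    periodicExp L p = Real.exp (-‖(p : AddCircle (2 * π * L))‖) := by
  have : 2 * π * L ≠ 0 := by positivity
  rw [periodicExp, AddCircle.norm_eq, round_eq]
  congr 3
  rw [show (2 * π * L)⁻¹ * p = p / (2 * π * L) by ring]
  ring

lemma periodicExp_continuous {L : ℝ} (hL : 0 < L) : Continuous (periodicExp L) := by
  rw [show periodicExp L = fun p : ℝ => Real.exp (-‖(p : AddCircle (2 * π * L))‖) from
    funext fun p => periodicExp_eq hL p]
  exact Real.continuous_exp.comp (continuous_norm.comp (AddCircle.continuous_mk' _)).neg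

lemma periodicExp_periodic {L : ℝ} (hL : 0 < L) :
    Function.Periodic (periodicExp L) (2 * π * L) := fun p => by
  rw [periodicExp_eq hL, periodicExp_eq hL, AddCircle.coe_add_period]

lemma periodicExp_eq_exp_neg_abs {L : ℝ} (hL : 0 < L) {p : ℝ} (hp : |p| ≤ π * L) :
    periodicExp L p = Real.exp (-|p|) := by
  have h0 : 0 < 2 * π * L := by positivity
  rw [periodicExp_eq hL, (AddCircle.norm_coe_eq_abs_iff _ h0.ne').2]
  rw [abs_of_pos h0]
  linarith

/-- Beyond the half period the profile and its periodisation differ at most by the contribution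
of the neighbouring copy of the profile. -/
lemma abs_periodicExp_sub_le {L : ℝ} (hL : 0 < L) (p : ℝ) :
    |periodicExp L p - Real.exp (-|p|)| ≤ Real.exp (|p| - 2 * (π * L)) := by
  have h0 : 0 < π * L := by positivity
  rcases le_or_gt |p| (π * L) with hp | hp
  · rw [periodicExp_eq_exp_neg_abs hL hp, sub_self, abs_zero]
    positivity
  · have h1 : ‖(p : AddCircle (2 * π * L))‖ ≤ |p| := by
      refine (AddCircle.norm_le_half_period _ (by positivity)).trans ?_
      rw [abs_of_pos (by positivity)]
      linarith
    have h2 : 2 * (π * L) - |p| ≤ ‖(p : AddCircle (2 * π * L))‖ := by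
      rw [AddCircle.norm_eq]
      set m := round ((2 * π * L)⁻¹ * p)
      rcases eq_or_ne m 0 with hm | hm
      · rw [hm, Int.cast_zero, zero_mul, sub_zero]
        linarith
      · have hm1 : (1 : ℝ) ≤ |(m : ℝ)| := by exact_mod_cast Int.one_le_abs hm
        have h3 := abs_sub_abs_le_abs_sub ((m : ℝ) * (2 * π * L)) p
        rw [abs_sub_comm, abs_mul, abs_of_pos (show 0 < 2 * π * L by positivity)] at h3
        nlinarith
    rw [periodicExp_eq hL, abs_of_nonneg (sub_nonneg.2 (Real.exp_le_exp.2 (neg_le_neg h1)))]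
    have h4 := Real.exp_le_exp.2 (show -‖(p : AddCircle (2 * π * L))‖ ≤ |p| - 2 * (π * L) by
      linarith)
    linarith [Real.exp_pos (-|p|)]

lemma lintegral_deriv_eq_ofReal_sub {a b : ℝ} (hab : a ≤ b) {F F' : ℝ → ℝ}
    (hF : ∀ t, HasDerivAt F (F' t) t) (hF' : Continuous F') (hpos : ∀ t, 0 ≤ F' t) :
    ∫⁻ t in Icc a b, ENNReal.ofReal (F' t) = ENNReal.ofReal (F b - F a) := by
  rw [← intervalIntegral.integral_eq_sub_of_hasDerivAt (fun t _ => hF t)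
      (hF'.intervalIntegrable a b), intervalIntegral.integral_of_le hab,
    ← integral_Icc_eq_integral_Ioc, ofReal_integral_eq_lintegral_ofReal
      hF'.integrableOn_Icc (ae_of_all _ hpos)]

/-- The defect of the periodised profile on the boundary `p = -πL`, accumulated in time by a
wave of speed `y`. -/
lemma mul_lintegral_defect_le {T L y : ℝ} (hT : 0 ≤ T) (hL : 0 < L) (hy : 0 ≤ y) :
    ENNReal.ofReal y * ∫⁻ t in Icc 0 T, ENNReal.ofReal
      ((periodicExp L (-(π * L) + y * (t - T)) - Real.exp (-|-(π * L) + y * (t - T)|)) ^ 2) ≤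
      ENNReal.ofReal (1 / 2 * Real.exp (2 * (y * T) - 2 * (π * L))) := by
  have h0 : 0 < π * L := by positivity
  let F : ℝ → ℝ := fun t => -(1 / 2) * Real.exp (2 * (y * (T - t) - π * L))
  have hF : ∀ t, HasDerivAt F (y * Real.exp (2 * (y * (T - t) - π * L))) t := by
    intro t
    have := (((((hasDerivAt_id t).const_sub T).const_mul y).sub_const (π * L)).const_mul
      2).exp.const_mul (-(1 / 2))
    refine this.congr_deriv ?_
    simp only [id]
    ring
  calc _ ≤ ENNReal.ofReal y * ∫⁻ t in Icc 0 T,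
        ENNReal.ofReal (Real.exp (2 * (y * (T - t) - π * L))) := by
        refine mul_le_mul_right (setLIntegral_mono (by fun_prop) fun t ht => ?_) _
        refine ENNReal.ofReal_le_ofReal ?_
        have h1 : 0 ≤ y * (T - t) := mul_nonneg hy (sub_nonneg.2 ht.2)
        have h := abs_periodicExp_sub_le hL (-(π * L) + y * (t - T))
        have habs : |-(π * L) + y * (t - T)| = π * L + y * (T - t) := by
          rw [abs_of_nonpos (by nlinarith)]
          ring
        rw [habs] at h ⊢
        rw [two_mul, Real.exp_add, ← sq, ← sq_abs]
        refine pow_le_pow_left₀ (abs_nonneg _) (h.trans (Real.exp_le_exp.2 ?_)) 2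
        linarith
    _ = ENNReal.ofReal (F T - F 0) := by
        rw [← lintegral_const_mul _ (by fun_prop), ← lintegral_deriv_eq_ofReal_sub hT hF
          (by fun_prop) (fun t => mul_nonneg hy (Real.exp_nonneg _))]
        simp only [ENNReal.ofReal_mul hy]
    _ ≤ _ := by
        refine ENNReal.ofReal_le_ofReal ?_
        simp only [F, sub_self, sub_zero, mul_sub, mul_zero]
        linarith [Real.exp_pos (0 - 2 * (π * L))]

/-- The defect of the periodised profile over one period, after transport over the distance
`Y`. -/
lemma lintegral_defect_le {L Y : ℝ} (hL : 0 < L) (hY : 0 ≤ Y) :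
    ∫⁻ p in Ioo (-(π * L)) (π * L), ENNReal.ofReal
      ((periodicExp L (p - Y) - Real.exp (-|p - Y|)) ^ 2) ≤
      ENNReal.ofReal (1 / 2 * Real.exp (2 * Y - 2 * (π * L))) := by
  have h0 : 0 < π * L := by positivity
  let F : ℝ → ℝ := fun p => -(1 / 2) * Real.exp (2 * (Y - p - 2 * (π * L)))
  have hF : ∀ p, HasDerivAt F (Real.exp (2 * (Y - p - 2 * (π * L)))) p := by
    intro p
    have := (((((hasDerivAt_id p).const_sub Y).sub_const (2 * (π * L))).const_mul
      2)).exp.const_mul (-(1 / 2))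
    refine this.congr_deriv ?_
    simp only [id]
    ring
  calc _ ≤ ∫⁻ p in Icc (-(π * L)) (π * L),
        ENNReal.ofReal (Real.exp (2 * (Y - p - 2 * (π * L)))) := by
        refine le_trans (setLIntegral_mono (g := fun p => ENNReal.ofReal
          (Real.exp (2 * (Y - p - 2 * (π * L))))) (by fun_prop) fun p hp => ?_)
          (lintegral_mono_set Ioo_subset_Icc_self)
        refine ENNReal.ofReal_le_ofReal ?_
        rcases le_or_gt |p - Y| (π * L) with h | h
        · rw [periodicExp_eq_exp_neg_abs hL h, sub_self, zero_pow two_ne_zero]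
          positivity
        · have hneg : p - Y < 0 := by
            by_contra! hcon
            rw [abs_of_nonneg hcon] at h
            linarith [hp.2]
          have hd := abs_periodicExp_sub_le hL (p - Y)
          rw [abs_of_neg hneg] at hd ⊢
          rw [two_mul, Real.exp_add, ← sq, ← sq_abs]
          refine pow_le_pow_left₀ (abs_nonneg _) (hd.trans (Real.exp_le_exp.2 ?_)) 2
          linarith
    _ = ENNReal.ofReal (F (π * L) - F (-(π * L))) :=
        lintegral_deriv_eq_ofReal_sub (by linarith) hF (by fun_prop) fun t => Real.exp_nonneg _
    _ ≤ _ := by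
        refine ENNReal.ofReal_le_ofReal ?_
        simp only [F]
        have h1 := Real.exp_pos (2 * (Y - π * L - 2 * (π * L)))
        rw [show 2 * (Y - -(π * L) - 2 * (π * L)) = 2 * Y - 2 * (π * L) by ring]
        linarith

/-! ### Sobolev norms of the solutions -/

lemma ennreal_rpow_half_sq (x : ℝ≥0∞) : (x ^ (1 / 2 : ℝ)) ^ 2 = x := by
  rw [← ENNReal.rpow_natCast, ← ENNReal.rpow_mul]
  norm_num

lemma ennreal_sq_add_sq_le (x y : ℝ≥0∞) : x ^ 2 + y ^ 2 ≤ (x + y) ^ 2 := by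
  rw [add_sq, add_right_comm]
  exact le_self_add

lemma sobolevNorm_sq (s : ℝ) (f : ℝ → ℂ) : sobolevNorm s f ^ 2 =
    ∑' k : ℤ, ENNReal.ofReal ((1 + (k : ℝ) ^ 2) ^ s) * ‖coeff f k‖ₑ ^ 2 :=
  ennreal_rpow_half_sq _

lemma sobolevNorm_zero_sq (f : ℝ → ℂ) : sobolevNorm 0 f ^ 2 = ∑' k : ℤ, ‖coeff f k‖ₑ ^ 2 := by
  simp [sobolevNorm_sq]

/-- The resolution condition `η ≥ (δ / ε)^{1/s}` bounds the `L²` norm of the frequencies above `η`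
by `ε`. -/
lemma tsum_highFreq_le {s η ε : ℝ} (hs : 0 < s) (hη : 0 < η) (hε : 0 < ε) {f : ℝ → ℂ}
    (h : (tailNorm s η f / ENNReal.ofReal ε) ^ (1 / s) ≤ ENNReal.ofReal η) :
    ∑' k : ℤ, (if η < |(k : ℝ)| then ‖coeff f k‖ₑ ^ 2 else 0) ≤ ENNReal.ofReal (ε ^ 2) := by
  have hε0 : ENNReal.ofReal ε ≠ 0 := by simpa using hε
  rw [one_div, ENNReal.rpow_inv_le_iff hs,
    ENNReal.div_le_iff hε0 ENNReal.ofReal_ne_top, ENNReal.ofReal_rpow_of_pos hη] at h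
  have h2 := pow_le_pow_left₀ (zero_le) h 2
  have hηs : 0 < η ^ s := Real.rpow_pos_of_pos hη s
  rw [mul_pow, tailNorm, ennreal_rpow_half_sq, ← ENNReal.ofReal_pow hε.le,
    ← ENNReal.ofReal_pow hηs.le] at h2
  have hsub := tsum_subtype {k : ℤ | η < |(k : ℝ)|}
    (fun k : ℤ => ENNReal.ofReal ((1 + (k : ℝ) ^ 2) ^ s) * ‖coeff f k‖ₑ ^ 2)
  replace h2 := hsub.symm.trans_le h2
  have h0 : ENNReal.ofReal ((η ^ s) ^ 2) ≠ 0 := (ENNReal.ofReal_pos.2 (pow_pos hηs 2)).ne'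
  rw [← ENNReal.mul_le_mul_iff_right h0 ENNReal.ofReal_ne_top, ← ENNReal.tsum_mul_left]
  refine (ENNReal.tsum_le_tsum fun k => ?_).trans h2
  by_cases hk : η < |(k : ℝ)|
  · rw [if_pos hk, indicator_of_mem (show k ∈ {k : ℤ | η < |(k : ℝ)|} from hk)]
    gcongr
    rw [← Real.rpow_natCast, ← Real.rpow_mul hη.le, mul_comm, Real.rpow_mul hη.le]
    refine Real.rpow_le_rpow (by positivity) ?_ hs.le
    rw [← sq_abs (k : ℝ), Nat.cast_ofNat, Real.rpow_two]
    nlinarith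
  · rw [if_neg hk, mul_zero]
    exact zero_le

lemma IsHeatSolution.enorm_coeff_sq {T : ℝ} (hT : 0 ≤ T) {u : ℝ → ℝ → ℂ} (hu : IsHeatSolution T u)
    (k : ℤ) : ‖coeff (u T) k‖ₑ ^ 2 =
      ENNReal.ofReal (Real.exp (-(2 * ((k : ℝ) ^ 2 * T)))) * ‖coeff (u 0) k‖ₑ ^ 2 := by
  rw [hu.coeff_eq ⟨hT, le_rfl⟩ k, enorm_ofReal_mul_sq, ← Real.exp_nat_mul]
  congr 3
  push_cast
  ring

lemma IsSchrodingerisedSolution.coeff_zero_eq {T : ℝ} (hT : 0 < T) {g : ℝ → ℝ} {uT : ℝ → ℂ}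
    {w : ℝ → ℝ → ℝ → ℂ} (hw : IsSchrodingerisedSolution T g uT w) (p : ℝ) (k : ℤ) :
    coeff (fun x => w 0 x p) k = g (p - (k : ℝ) ^ 2 * T) * coeff uT k := by
  rw [hw.coeff_eq hT ⟨le_rfl, hT.le⟩]
  congr 3
  ring

lemma tsum_le_mixedNorm_sq {T s : ℝ} (hT : 0 < T) {uT : ℝ → ℂ} {w : ℝ → ℝ → ℝ → ℂ}
    (hw : IsSchrodingerisedSolution T (fun p => Real.exp (-|p|)) uT w) :
    ∑' k : ℤ, ENNReal.ofReal ((1 + (k : ℝ) ^ 2) ^ s) * ‖coeff uT k‖ₑ ^ 2 ≤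
      mixedNorm s (w 0) ^ 2 := by
  rw [mixedNorm, ennreal_rpow_half_sq]
  refine ENNReal.tsum_le_tsum fun k => ?_
  simp only [hw.coeff_zero_eq hT]
  gcongr
  exact enorm_sq_le_lineH1NormSq _ _

lemma mixedNorm_lt_top {T s : ℝ} (hT : 0 < T) {u : ℝ → ℝ → ℂ} (hu : IsHeatSolution T u)
    {w : ℝ → ℝ → ℝ → ℂ}
    (hw : IsSchrodingerisedSolution T (fun p => Real.exp (-|p|)) (u T) w)
    (h0 : sobolevNorm s (u 0) < ⊤) : mixedNorm s (w 0) < ⊤ := by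
  refine ENNReal.rpow_lt_top_of_nonneg (by norm_num) (ne_of_lt ?_)
  have h1 : 2 * sobolevNorm s (u 0) ^ 2 < ⊤ := ENNReal.mul_lt_top (by simp) (by finiteness)
  refine lt_of_le_of_lt ?_ h1
  rw [sobolevNorm_sq, ← ENNReal.tsum_mul_left]
  refine ENNReal.tsum_le_tsum fun k => ?_
  simp only [hw.coeff_zero_eq hT]
  rw [mul_left_comm]
  gcongr
  refine (lineH1NormSq_le _ _).trans ?_
  rw [hu.enorm_coeff_sq hT.le]
  gcongr
  refine mul_le_of_le_one_left (zero_le) ?_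
  rw [ENNReal.ofReal_le_one, Real.exp_le_one_iff]
  have : 0 ≤ (k : ℝ) ^ 2 * T := by positivity
  linarith

/-! ### Comparison of the periodic and the whole-line problem -/

/-- The factor `½ e^{2k²T - 2πL}` bounds the defect of the mode `k`. Frequencies below `η` use
`k² ≤ η²`; above `η` the growth is absorbed by the decay `û_T(k) = e^{-k²T} û_0(k)`. -/
lemma tsum_defect_le {T L s η ε : ℝ} (hT : 0 < T) (hs : 0 < s) (hη : 0 < η)
    (hε : 0 < ε) {u : ℝ → ℝ → ℂ} (hu : IsHeatSolution T u)
    (h : (tailNorm s η (u 0) / ENNReal.ofReal ε) ^ (1 / s) ≤ ENNReal.ofReal η) :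
    ∑' k : ℤ, ENNReal.ofReal (1 / 2 * Real.exp (2 * ((k : ℝ) ^ 2 * T) - 2 * (π * L))) *
        ‖coeff (u T) k‖ₑ ^ 2 ≤
      ENNReal.ofReal (1 / 2 * Real.exp (2 * (η ^ 2 * T) - 2 * (π * L))) * sobolevNorm 0 (u T) ^ 2 +
        ENNReal.ofReal (1 / 2 * Real.exp (-(2 * (π * L))) * ε ^ 2) := by
  rw [ENNReal.ofReal_mul (by positivity : (0 : ℝ) ≤ 1 / 2 * Real.exp (-(2 * (π * L))))]
  refine le_trans ?_ (add_le_add_right (mul_le_mul_right (tsum_highFreq_le hs hη hε h) _) _)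
  rw [sobolevNorm_zero_sq, ← ENNReal.tsum_mul_left, ← ENNReal.tsum_mul_left, ← ENNReal.tsum_add]
  refine ENNReal.tsum_le_tsum fun k => ?_
  by_cases hk : η < |(k : ℝ)|
  · rw [if_pos hk]
    refine le_trans (le_of_eq ?_) le_add_self
    rw [hu.enorm_coeff_sq hT.le, ← mul_assoc, ← ENNReal.ofReal_mul (by positivity), mul_assoc,
      ← Real.exp_add]
    congr 4
    ring
  · rw [if_neg hk, mul_zero, add_zero]
    have hk2 : (k : ℝ) ^ 2 ≤ η ^ 2 := by
      rw [← sq_abs]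
      exact pow_le_pow_left₀ (abs_nonneg _) (not_lt.1 hk) 2
    gcongr

lemma continuous_slice {T : ℝ} {g : ℝ → ℝ} {uT : ℝ → ℂ} {w : ℝ → ℝ → ℝ → ℂ}
    (hw : IsSchrodingerisedSolution T g uT w) {t : ℝ} (ht : t ∈ Icc 0 T) :
    Continuous fun q : ℝ × ℝ => w t q.1 q.2 :=
  hw.continuousOn.comp_continuous (f := fun q : ℝ × ℝ => (t, q.1, q.2)) (by fun_prop)
    fun _ => ⟨ht, trivial⟩

theorem lintegral_seminormH1Sq_boundary_le {T L s η ε : ℝ} (hT : 0 < T) (hL : 0 < L) (hs : 0 < s)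
    (hη : 0 < η) (hε : 0 < ε) {u : ℝ → ℝ → ℂ} {w W : ℝ → ℝ → ℝ → ℂ} (hu : IsHeatSolution T u)
    (hw : IsSchrodingerisedSolution T (fun p => Real.exp (-|p|)) (u T) w)
    (hW : IsPeriodicSolution T L (u T) W)
    (h : (tailNorm s η (u 0) / ENNReal.ofReal ε) ^ (1 / s) ≤ ENNReal.ofReal η)
    (hL3 : 3 * η ^ 2 * T < π * L) :
    ∫⁻ t in Icc 0 T, seminormH1Sq (fun x => W t x (-(π * L)) - w t x (-(π * L))) ≤
      ENNReal.ofReal (5 / 2 * Real.exp (-(2 * (π * L - 3 * η ^ 2 * T)))) * sobolevNorm 0 (u T) ^ 2 +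
        ENNReal.ofReal (Real.exp (-(3 * η ^ 2 * T)) * ε ^ 2) := by
  have hG := periodicExp_continuous hL
  have ha : 0 < η ^ 2 * T := by positivity
  let D : ℤ → ℝ → ℝ := fun k t => (periodicExp L (-(π * L) + (k : ℝ) ^ 2 * (t - T)) -
    Real.exp (-|-(π * L) + (k : ℝ) ^ 2 * (t - T)|)) ^ 2
  have hD : ∀ k, Continuous (D k) := fun k => by
    have : Continuous fun t : ℝ => periodicExp L (-(π * L) + (k : ℝ) ^ 2 * (t - T)) :=
      hG.comp (by fun_prop)
    fun_prop
  have h1 : ∀ t ∈ Icc 0 T, seminormH1Sq (fun x => W t x (-(π * L)) - w t x (-(π * L))) =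
      ∑' k : ℤ, ENNReal.ofReal ((k : ℝ) ^ 2) * (ENNReal.ofReal (D k t) * ‖coeff (u T) k‖ₑ ^ 2) := by
    intro t ht
    rw [seminormH1Sq]
    refine tsum_congr fun k => ?_
    have hcs : ∀ {g : ℝ → ℝ} {v : ℝ → ℝ → ℝ → ℂ}, IsSchrodingerisedSolution T g (u T) v →
        Continuous fun x => v t x (-(π * L)) := fun hv =>
      (continuous_slice hv ht).comp (f := fun x : ℝ => (x, -(π * L))) (by fun_prop)
    rw [coeff_sub (hcs hW.solution) (hcs hw), hW.solution.coeff_eq hT ht, hw.coeff_eq hT ht,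
      ← sub_mul, ← Complex.ofReal_sub, enorm_ofReal_mul_sq]
  rw [setLIntegral_congr_fun measurableSet_Icc h1, lintegral_tsum fun k => by
    have := (hD k).measurable
    fun_prop]
  have h2 : ∀ k : ℤ, ∫⁻ t in Icc 0 T,
      ENNReal.ofReal ((k : ℝ) ^ 2) * (ENNReal.ofReal (D k t) * ‖coeff (u T) k‖ₑ ^ 2) ≤
      ENNReal.ofReal (1 / 2 * Real.exp (2 * ((k : ℝ) ^ 2 * T) - 2 * (π * L))) *
        ‖coeff (u T) k‖ₑ ^ 2 := by
    intro k
    have hm := (hD k).measurable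
    rw [lintegral_const_mul _ (by fun_prop), lintegral_mul_const _ (by fun_prop), ← mul_assoc]
    gcongr
    exact mul_lintegral_defect_le hT.le hL (sq_nonneg _)
  refine (ENNReal.tsum_le_tsum h2).trans ((tsum_defect_le hT hs hη hε hu h).trans ?_)
  gcongr
  · norm_num
  · linarith
  · have : Real.exp (-(2 * (π * L))) ≤ Real.exp (-(3 * η ^ 2 * T)) :=
      Real.exp_le_exp.2 (by linarith)
    linarith [Real.exp_pos (-(2 * (π * L)))]

theorem boxL2Norm_sub_le {T L s η ε : ℝ} (hT : 0 < T) (hL : 0 < L) (hs : 0 < s)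
    (hη : 0 < η) (hε : 0 < ε) {u : ℝ → ℝ → ℂ} {w W : ℝ → ℝ → ℝ → ℂ} (hu : IsHeatSolution T u)
    (hw : IsSchrodingerisedSolution T (fun p => Real.exp (-|p|)) (u T) w)
    (hW : IsPeriodicSolution T L (u T) W)
    (h : (tailNorm s η (u 0) / ENNReal.ofReal ε) ^ (1 / s) ≤ ENNReal.ofReal η)
    (hL3 : 3 * η ^ 2 * T < π * L) :
    boxL2Norm (-(π * L)) (π * L) (fun x p => w 0 x p - W 0 x p) ≤
      2 * (ENNReal.ofReal (Real.exp (-(π * L - 3 * η ^ 2 * T))) * sobolevNorm 0 (u T) +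
        ENNReal.ofReal (Real.exp (-(3 / 2 * η ^ 2 * T)) * ε)) := by
  have ha : 0 < η ^ 2 * T := by positivity
  have h00 : (0 : ℝ) ∈ Icc 0 T := ⟨le_rfl, hT.le⟩
  have hcw := continuous_slice hw h00
  have hcW := continuous_slice hW.solution h00
  rw [← ENNReal.pow_le_pow_left_iff two_ne_zero, boxL2Norm_sq_eq_tsum _ _ (hcw.sub hcW)]
  have h1 : ∀ (k : ℤ) p, ‖coeff (fun x => w 0 x p - W 0 x p) k‖ₑ ^ 2 =
      ENNReal.ofReal ((periodicExp L (p - (k : ℝ) ^ 2 * T) -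
        Real.exp (-|p - (k : ℝ) ^ 2 * T|)) ^ 2) * ‖coeff (u T) k‖ₑ ^ 2 := by
    intro k p
    have hx : Continuous fun x : ℝ => (x, p) := by fun_prop
    rw [coeff_sub (f := fun x => w 0 x p) (g := fun x => W 0 x p) (hcw.comp hx) (hcW.comp hx),
      hW.solution.coeff_zero_eq hT,
      hw.coeff_zero_eq hT, ← sub_mul, ← Complex.ofReal_sub, enorm_ofReal_mul_sq, ← neg_sq, neg_sub]
  have h2 : ∀ k : ℤ, ∫⁻ p in Ioo (-(π * L)) (π * L),
      ‖coeff (fun x => w 0 x p - W 0 x p) k‖ₑ ^ 2 ≤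
      ENNReal.ofReal (1 / 2 * Real.exp (2 * ((k : ℝ) ^ 2 * T) - 2 * (π * L))) *
        ‖coeff (u T) k‖ₑ ^ 2 := by
    intro k
    have hm : Measurable fun p => periodicExp L (p - (k : ℝ) ^ 2 * T) :=
      (periodicExp_continuous hL).measurable.comp (by fun_prop)
    simp only [h1]
    rw [lintegral_mul_const _ (by fun_prop)]
    gcongr
    exact lintegral_defect_le hL (by positivity)
  refine (mul_le_mul_right ((ENNReal.tsum_le_tsum h2).trans
    (tsum_defect_le hT hs hη hε hu h)) _).trans ?_
  rw [mul_pow, mul_add]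
  refine le_trans ?_ (mul_le_mul_right (ennreal_sq_add_sq_le _ _) _)
  have hpi := Real.pi_le_four
  have h4 : (2 : ℝ≥0∞) ^ 2 = ENNReal.ofReal 4 := by
    rw [show (4 : ℝ) = 2 ^ 2 by norm_num, ENNReal.ofReal_pow (by norm_num)]
    norm_num
  have hexp : ∀ x y z : ℝ, 2 * z ≤ 2 * y → 0 ≤ x →
      2 * π * (1 / 2 * Real.exp (2 * z) * x) ≤ 4 * (Real.exp y ^ 2 * x) := by
    intro x y z hzy hx
    rw [← Real.exp_nat_mul, Nat.cast_ofNat]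
    have h2 : Real.exp (2 * z) * x ≤ Real.exp (2 * y) * x := by gcongr
    have h3 := mul_le_mul_of_nonneg_right hpi (mul_nonneg (Real.exp_nonneg (2 * z)) hx)
    linarith
  rw [mul_add, mul_pow, h4, ← mul_assoc (ENNReal.ofReal (2 * π)), ← mul_assoc (ENNReal.ofReal 4),
    ← ENNReal.ofReal_pow (Real.exp_nonneg _), ← ENNReal.ofReal_pow (by positivity),
    ← ENNReal.ofReal_mul (by positivity), ← ENNReal.ofReal_mul (by positivity),
    ← ENNReal.ofReal_mul (by norm_num), ← ENNReal.ofReal_mul (by norm_num)]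
  gcongr ENNReal.ofReal ?_ * _ + ENNReal.ofReal ?_
  · have := hexp 1 (-(π * L - 3 * η ^ 2 * T)) (η ^ 2 * T - π * L) (by linarith) zero_le_one
    rwa [mul_one, mul_one, mul_sub] at this
  · have := hexp (ε ^ 2) (-(3 / 2 * η ^ 2 * T)) (-(π * L)) (by linarith) (sq_nonneg _)
    rwa [mul_neg, ← mul_pow] at this

/-! ### Trigonometric interpolation -/

/-- The values of the basis functions at the grid points of `(-π, π)`. -/
noncomputable def gridMatrix (m : ℕ) : Matrix (Fin m) (Fin m) ℂ :=
  Matrix.of fun i j => basisX m j (gridX m i)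

/-- The mode coefficients of the trigonometric interpolant of `f`. -/
noncomputable def interpCoeff (m : ℕ) (f : ℝ → ℂ) : Fin m → ℂ :=
  (gridMatrix m)⁻¹ *ᵥ fun i => f (gridX m i)

/-- The trigonometric interpolant of `f` on `m` grid points. -/
noncomputable def interp (m : ℕ) (f : ℝ → ℂ) (x : ℝ) : ℂ :=
  ∑ j, interpCoeff m f j * basisX m j x

/-- Every frequency is `j - m / 2 + r m` for exactly one resolved frequency `j - m / 2` and one
`r`; frequencies with the same `j` are aliases of each other on the grid. -/
noncomputable def modeEquiv (m : ℕ) [NeZero m] : Fin m × ℤ ≃ ℤ :=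
  ((Equiv.prodComm _ _).trans (Int.divModEquiv m).symm).trans (Equiv.subRight ((m / 2 : ℕ) : ℤ))

lemma modeEquiv_apply (m : ℕ) [NeZero m] (j : Fin m) (r : ℤ) :
    modeEquiv m (j, r) = r * m + (j : ℕ) - (m / 2 : ℕ) := by
  simp [modeEquiv]

lemma cast_half {m : ℕ} (hm : Even m) : ((m / 2 : ℕ) : ℝ) = (m : ℝ) / 2 := by
  obtain ⟨h, rfl⟩ := hm
  rw [show (h + h) / 2 = h by lia]
  push_cast
  ring

lemma cast_modeEquiv {m : ℕ} [NeZero m] (hm : Even m) (j : Fin m) (r : ℤ) :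
    ((modeEquiv m (j, r) : ℤ) : ℝ) = r * m + freqX m j := by
  rw [modeEquiv_apply, freqX, ← cast_half hm]
  simp only [Int.cast_sub, Int.cast_add, Int.cast_mul, Int.cast_natCast]
  ring

lemma modeEquiv_eq_add (m : ℕ) [NeZero m] (j : Fin m) (r : ℤ) :
    modeEquiv m (j, r) = modeEquiv m (j, 0) + r * m := by
  rw [modeEquiv_apply, modeEquiv_apply]
  ring

lemma basisX_eq {m : ℕ} [NeZero m] (hm : Even m) (j : Fin m) (x : ℝ) :
    basisX m j x = expMode (modeEquiv m (j, 0)) (x + π) := by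
  rw [basisX, expMode, cast_modeEquiv hm]
  simp

@[fun_prop]
lemma basisX_continuous (m : ℕ) (j : Fin m) : Continuous (basisX m j) := by
  unfold basisX
  fun_prop

@[fun_prop]
lemma interp_continuous (m : ℕ) (f : ℝ → ℂ) : Continuous (interp m f) := by
  unfold interp
  fun_prop

lemma basisX_periodic {m : ℕ} [NeZero m] (hm : Even m) (j : Fin m) :
    Function.Periodic (basisX m j) (2 * π) := fun x => by
  rw [basisX_eq hm, basisX_eq hm, add_right_comm, expMode_periodic]

lemma interp_periodic {m : ℕ} [NeZero m] (hm : Even m) (f : ℝ → ℂ) :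
    Function.Periodic (interp m f) (2 * π) := fun x => by
  simp only [interp, basisX_periodic hm _ x]

lemma coeff_basisX {m : ℕ} [NeZero m] (hm : Even m) (j : Fin m) (k : ℤ) :
    coeff (basisX m j) k =
      if modeEquiv m (j, 0) = k then expMode (modeEquiv m (j, 0)) π else 0 := by
  have : basisX m j = fun x => expMode (modeEquiv m (j, 0)) π * expMode (modeEquiv m (j, 0)) x := by
    funext x
    rw [basisX_eq hm, expMode_add, mul_comm]
  rw [this, coeff_const_mul, coeff_expMode, mul_ite, mul_one, mul_zero]

lemma gridMatrix_det_isUnit (m : ℕ) : IsUnit (gridMatrix m).det := by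
  rcases Nat.eq_zero_or_pos m with rfl | hm
  · simp
  have hm0 : (m : ℝ) ≠ 0 := by exact_mod_cast hm.ne'
  let v : Fin m → ℂ := fun j => Complex.exp (Complex.I * ((freqX m j * (2 * π / m) : ℝ) : ℂ))
  have hE : gridMatrix m = (Matrix.vandermonde v)ᵀ := by
    ext i j
    simp only [gridMatrix, Matrix.of_apply, Matrix.transpose_apply, Matrix.vandermonde_apply, v,
      basisX, gridX, ← Complex.exp_nat_mul]
    congr 1
    push_cast
    ring
  rw [hE, Matrix.det_transpose, isUnit_iff_ne_zero, Matrix.det_vandermonde_ne_zero_iff]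
  intro i j hij
  obtain ⟨n, hn⟩ := Complex.exp_eq_exp_iff_exists_int.1 hij
  have hI : Complex.I * ((freqX m i * (2 * π / m) : ℝ) : ℂ) =
      Complex.I * ((freqX m j * (2 * π / m) + n * (2 * π) : ℝ) : ℂ) := by
    rw [hn]
    push_cast
    ring
  have hre : freqX m i * (2 * π / m) = freqX m j * (2 * π / m) + n * (2 * π) := by
    exact_mod_cast mul_left_cancel₀ Complex.I_ne_zero hI
  have hnm : (i : ℝ) = (j : ℝ) + n * m := by
    simp only [freqX] at hre
    field_simp at hre
    linarith
  have hnm' : ((i : ℕ) : ℤ) = ((j : ℕ) : ℤ) + n * m := by exact_mod_cast hnm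
  have h1 := i.2
  have h2 := j.2
  have hn0 : n = 0 := by
    by_contra hne
    rcases lt_or_gt_of_ne hne with h | h <;> nlinarith
  rw [hn0, zero_mul, add_zero] at hnm'
  exact Fin.ext (by exact_mod_cast hnm')

/-- On the grid, all aliases of a frequency coincide. Because `m` is even, no sign appears. -/
lemma expMode_modeEquiv_gridX {m : ℕ} [NeZero m] (hm : Even m) (j : Fin m) (r : ℤ) (i : Fin m) :
    expMode (modeEquiv m (j, r)) (gridX m i) =
      expMode (modeEquiv m (j, 0)) (-π) * basisX m j (gridX m i) := by
  have hm0 : (m : ℂ) ≠ 0 := by exact_mod_cast NeZero.ne m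
  rw [basisX_eq hm, ← expMode_add, modeEquiv_eq_add, expMode_add_index,
    show -π + (gridX m i + π) = gridX m i by ring]
  refine mul_eq_left₀ ?_ |>.2 ?_
  · rw [← norm_ne_zero_iff, norm_expMode]
    exact one_ne_zero
  · obtain ⟨h, hh⟩ := hm
    rw [expMode, Complex.exp_eq_one_iff]
    refine ⟨r * i - r * h, ?_⟩
    have hh' : (m : ℂ) = 2 * h := by
      rw [hh]
      push_cast
      ring
    rw [gridX]
    push_cast
    field_simp
    rw [hh']
    ring

/-- Aliasing: the interpolant collects in each resolved frequency the coefficients of all its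
aliases. -/
lemma coeff_interp {m : ℕ} [NeZero m] (hm : Even m) {f : ℝ → ℂ} (hf : Continuous f)
    (hp : Function.Periodic f (2 * π)) (hs : Summable (coeff f)) (j : Fin m) (r : ℤ) :
    coeff (interp m f) (modeEquiv m (j, r)) =
      if r = 0 then ∑' q, coeff f (modeEquiv m (j, q)) else 0 := by
  let B : Fin m → ℂ := fun j =>
    expMode (modeEquiv m (j, 0)) (-π) * ∑' q, coeff f (modeEquiv m (j, q))
  have hB : gridMatrix m *ᵥ B = fun i => f (gridX m i) := by
    funext i
    have h1 := (modeEquiv m).hasSum_iff.2 (hasSum_coeff_mul_expMode hf hp hs (gridX m i))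
    have h2 := h1.summable.tsum_prod
    rw [h1.tsum_eq, tsum_fintype] at h2
    rw [h2, Matrix.mulVec, dotProduct]
    refine Finset.sum_congr rfl fun j _ => ?_
    simp only [Function.comp_apply, expMode_modeEquiv_gridX hm, tsum_mul_right, gridMatrix,
      Matrix.of_apply, B]
    ring
  have hc : interpCoeff m f = B := by
    rw [interpCoeff, ← hB, Matrix.mulVec_mulVec, Matrix.nonsing_inv_mul _ (gridMatrix_det_isUnit m),
      Matrix.one_mulVec]
  have hi : interp m f = fun x => ∑ j, B j * basisX m j x := by
    funext x
    rw [interp, hc]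
  rw [hi, coeff_finsetSum _ _ fun j => by fun_prop]
  simp only [coeff_const_mul, coeff_basisX hm]
  have hinj : ∀ j', modeEquiv m (j', 0) = modeEquiv m (j, r) ↔ j' = j ∧ r = 0 := by
    intro j'
    rw [(modeEquiv m).injective.eq_iff, Prod.mk.injEq]
    exact and_congr_right fun _ => eq_comm
  simp only [hinj]
  by_cases hr : r = 0
  · have h1 : expMode (modeEquiv m (j, 0)) (-π) * expMode (modeEquiv m (j, 0)) π = 1 := by
      rw [← expMode_add, neg_add_cancel, expMode]
      simp
    simp only [hr, and_true, mul_ite, mul_zero, Finset.sum_ite_eq', Finset.mem_univ, if_true, B]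
    rw [mul_right_comm, h1, one_mul]
  · simp [hr]

/-- `∑_{r ≠ 0} r⁻²`, written over all integers because the term `r = 0` is `0⁻¹ = 0`. -/
noncomputable def invSqSum : ℝ≥0∞ := ∑' r : ℤ, ENNReal.ofReal (((r : ℝ) ^ 2)⁻¹)

lemma invSqSum_ne_top : invSqSum ≠ ⊤ := by
  have h : Summable fun r : ℤ => ((r : ℝ) ^ 2)⁻¹ := by
    simpa using Real.summable_one_div_int_pow (p := 2)
  exact h.tsum_ofReal_ne_top

/-- The Cauchy–Schwarz inequality with weights `r²`. -/
lemma sq_tsum_le (d : ℤ → ℝ≥0∞) (hd : d 0 = 0) :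
    (∑' r, d r) ^ 2 ≤ invSqSum * ∑' r : ℤ, ENNReal.ofReal ((r : ℝ) ^ 2) * d r ^ 2 := by
  let α : ℤ → ℝ≥0∞ := fun r => ENNReal.ofReal |(r : ℝ)|⁻¹
  let β : ℤ → ℝ≥0∞ := fun r => ENNReal.ofReal |(r : ℝ)| * d r
  have hαβ : ∀ r, d r = (α * β) r := by
    intro r
    rcases eq_or_ne r 0 with rfl | hr
    · simp [β, hd]
    · have : 0 < |(r : ℝ)| := abs_pos.2 (by exact_mod_cast hr)
      rw [Pi.mul_apply, ← mul_assoc, ← ENNReal.ofReal_mul (by positivity),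
        inv_mul_cancel₀ this.ne', ENNReal.ofReal_one, one_mul]
  have h := ENNReal.lintegral_mul_le_Lp_mul_Lq (Measure.count : Measure ℤ)
    Real.HolderConjugate.two_two (measurable_of_countable α).aemeasurable
    (measurable_of_countable β).aemeasurable
  simp only [lintegral_count] at h
  have h2 := pow_le_pow_left₀ zero_le h 2
  rw [mul_pow, ennreal_rpow_half_sq, ennreal_rpow_half_sq] at h2
  simp only [← hαβ] at h2
  refine h2.trans (le_of_eq ?_)
  congr 1
  · refine tsum_congr fun r => ?_
    rw [ENNReal.rpow_two, ← ENNReal.ofReal_pow (by positivity), inv_pow, sq_abs]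
  · refine tsum_congr fun r => ?_
    rw [ENNReal.rpow_two, mul_pow, ← ENNReal.ofReal_pow (by positivity), sq_abs]

lemma summable_coeff_of_weight {f : ℝ → ℂ} {wt : ℤ → ℝ≥0∞}
    (h_wt : ∀ k : ℤ, ENNReal.ofReal ((k : ℝ) ^ 2) ≤ wt k)
    (hfin : ∑' k, wt k * ‖coeff f k‖ₑ ^ 2 ≠ ⊤) : Summable (coeff f) := by
  let d : ℤ → ℝ≥0∞ := fun k => if k = 0 then 0 else ‖coeff f k‖ₑ
  have h1 : (∑' k, d k) ^ 2 ≠ ⊤ := by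
    refine ne_top_of_le_ne_top (ENNReal.mul_ne_top invSqSum_ne_top hfin)
      ((sq_tsum_le d (if_pos rfl)).trans ?_)
    gcongr with k
    · exact h_wt k
    · simp only [d]
      split_ifs <;> simp
  have h2 : ∑' k, d k ≠ ⊤ := fun h => h1 (by rw [h, ENNReal.top_pow two_ne_zero])
  have h3 : ∑' k, ‖coeff f k‖ₑ ≠ ⊤ := by
    have h4 : ∀ k, ‖coeff f k‖ₑ = (if k = 0 then ‖coeff f 0‖ₑ else 0) + d k := by
      intro k
      simp only [d]
      split_ifs with hk <;> simp [hk]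
    rw [tsum_congr h4, ENNReal.tsum_add, tsum_ite_eq 0 fun _ => ‖coeff f 0‖ₑ]
    exact ENNReal.add_ne_top.2 ⟨enorm_ne_top, h2⟩
  exact (tsum_enorm_ne_top_iff_summable_nnnorm.1 h3).of_nnnorm

/-- The interpolation error in `L²`. The weight `wt` is a Sobolev weight, and `ρ` the resulting
gain: `r` periods away from the resolved frequencies `wt` is at least `r² ρ`. -/
theorem tsum_coeff_sub_interp_le {m : ℕ} [NeZero m] (hm : Even m) {f : ℝ → ℂ} (hf : Continuous f)
    (hp : Function.Periodic f (2 * π)) {wt : ℤ → ℝ≥0∞} {ρ : ℝ≥0∞}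
    (h_wt : ∀ k : ℤ, ENNReal.ofReal ((k : ℝ) ^ 2) ≤ wt k)
    (hρ : ∀ (j : Fin m) (r : ℤ), ENNReal.ofReal ((r : ℝ) ^ 2) * ρ ≤ wt (modeEquiv m (j, r)))
    (hfin : ∑' k, wt k * ‖coeff f k‖ₑ ^ 2 ≠ ⊤) :
    ρ * ∑' k, ‖coeff f k - coeff (interp m f) k‖ₑ ^ 2 ≤
      (invSqSum + 1) * ∑' k, wt k * ‖coeff f k‖ₑ ^ 2 := by
  have hs := summable_coeff_of_weight h_wt hfin
  rw [← (modeEquiv m).tsum_eq, ← (modeEquiv m).tsum_eq (fun k => wt k * ‖coeff f k‖ₑ ^ 2),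
    ENNReal.tsum_prod', ENNReal.tsum_prod', ← ENNReal.tsum_mul_left, ← ENNReal.tsum_mul_left]
  refine ENNReal.tsum_le_tsum fun j => ?_
  let c : ℤ → ℂ := fun r => coeff f (modeEquiv m (j, r))
  have hc : Summable c := hs.comp_injective fun a b hab => by simpa using hab
  let d : ℤ → ℝ≥0∞ := fun r => if r = 0 then 0 else ‖c r‖ₑ
  have hterm : ∀ r, ‖c r - coeff (interp m f) (modeEquiv m (j, r))‖ₑ ^ 2 ≤
      (if r = 0 then (∑' q, d q) ^ 2 else 0) + d r ^ 2 := by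
    intro r
    rw [coeff_interp hm hf hp hs]
    by_cases hr : r = 0
    · subst hr
      simp only [if_true]
      refine le_add_right ?_
      have h1 := hc.tsum_eq_add_tsum_ite 0
      rw [show ∑' q, coeff f (modeEquiv m (j, q)) = ∑' q, c q from rfl, h1, sub_add_cancel_left,
        enorm_neg]
      gcongr
      refine (enorm_tsum_le_tsum_enorm).trans (le_of_eq (tsum_congr fun q => ?_))
      simp only [d]
      split_ifs <;> simp
    · simp [hr, d]
  calc ρ * ∑' r, ‖c r - coeff (interp m f) (modeEquiv m (j, r))‖ₑ ^ 2
      ≤ ρ * ((∑' q, d q) ^ 2 + ∑' r, d r ^ 2) := by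
        refine mul_le_mul_right ((ENNReal.tsum_le_tsum hterm).trans (le_of_eq ?_)) _
        rw [ENNReal.tsum_add, tsum_ite_eq]
    _ ≤ ρ * ((invSqSum + 1) * ∑' r : ℤ, ENNReal.ofReal ((r : ℝ) ^ 2) * d r ^ 2) := by
        rw [add_mul, one_mul]
        gcongr with r
        · exact sq_tsum_le d (if_pos rfl)
        · by_cases hr : r = 0
          · simp [d, hr]
          · have h1 : (1 : ℝ) ≤ (r : ℝ) ^ 2 := by
              exact_mod_cast Int.one_le_abs (pow_ne_zero 2 hr) |>.trans_eq
                (abs_of_nonneg (sq_nonneg r))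
            exact le_mul_of_one_le_left zero_le (by simpa using h1)
    _ = (invSqSum + 1) * ∑' r : ℤ, (ENNReal.ofReal ((r : ℝ) ^ 2) * ρ) * d r ^ 2 := by
        rw [mul_left_comm, ← ENNReal.tsum_mul_left]
        congr 1
        refine tsum_congr fun r => ?_
        ring
    _ ≤ (invSqSum + 1) * ∑' r, wt (modeEquiv m (j, r)) * ‖c r‖ₑ ^ 2 := by
        gcongr with r
        · exact hρ j r
        · simp only [d]
          split_ifs <;> simp

lemma abs_freqX_le {m : ℕ} (j : Fin m) : |freqX m j| ≤ (m : ℝ) / 2 := by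
  have h : ((j : ℕ) : ℝ) ≤ m := by exact_mod_cast j.2.le
  have h0 : (0 : ℝ) ≤ ((j : ℕ) : ℝ) := Nat.cast_nonneg _
  rw [freqX, abs_le]
  constructor <;> linarith

/-- A frequency `r` periods away from a resolved one has modulus at least `|r| m / 2`. -/
lemma sq_mul_le_modeEquiv_sq {m : ℕ} [NeZero m] (hm : Even m) (j : Fin m) (r : ℤ) :
    (r : ℝ) ^ 2 * ((m : ℝ) / 2) ^ 2 ≤ (modeEquiv m (j, r) : ℝ) ^ 2 := by
  rw [cast_modeEquiv hm, ← mul_pow, sq_le_sq]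
  rcases eq_or_ne r 0 with rfl | hr
  · simp
  · have h1 : (1 : ℝ) ≤ |(r : ℝ)| := by exact_mod_cast Int.one_le_abs hr
    have hm0 : (0 : ℝ) ≤ m := Nat.cast_nonneg m
    have h2 := abs_freqX_le j
    have h3 := abs_sub_abs_le_abs_sub ((r : ℝ) * m) (-freqX m j)
    rw [sub_neg_eq_add, abs_neg, abs_mul, abs_of_nonneg hm0] at h3
    rw [abs_mul, abs_of_nonneg (by positivity : 0 ≤ (m : ℝ) / 2)]
    nlinarith

/-- The interpolation error in `L²` of a function in `H^s`. -/
lemma tsum_coeff_sub_interp_le_sobolev {m : ℕ} [NeZero m] (hm : Even m) {f : ℝ → ℂ}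
    (hf : Continuous f) (hp : Function.Periodic f (2 * π)) {s : ℝ} (hs : 1 ≤ s)
    (hfin : ∑' k : ℤ, ENNReal.ofReal ((1 + (k : ℝ) ^ 2) ^ s) * ‖coeff f k‖ₑ ^ 2 ≠ ⊤) :
    ENNReal.ofReal ((((m : ℝ) / 2) ^ 2) ^ s) *
        ∑' k, ‖coeff f k - coeff (interp m f) k‖ₑ ^ 2 ≤
      (invSqSum + 1) *
        ∑' k : ℤ, ENNReal.ofReal ((1 + (k : ℝ) ^ 2) ^ s) * ‖coeff f k‖ₑ ^ 2 := by
  refine tsum_coeff_sub_interp_le hm hf hp (fun k => ?_) (fun j r => ?_) hfin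
  · refine ENNReal.ofReal_le_ofReal ?_
    have h1 : (1 : ℝ) ≤ 1 + (k : ℝ) ^ 2 := by nlinarith [sq_nonneg (k : ℝ)]
    exact (by linarith : (k : ℝ) ^ 2 ≤ 1 + (k : ℝ) ^ 2).trans (Real.self_le_rpow_of_one_le h1 hs)
  · rw [← ENNReal.ofReal_mul (sq_nonneg _)]
    refine ENNReal.ofReal_le_ofReal ?_
    rcases eq_or_ne r 0 with rfl | hr
    · rw [Int.cast_zero, zero_pow two_ne_zero, zero_mul]
      positivity
    · have h1 : (1 : ℝ) ≤ (r : ℝ) ^ 2 := by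
        exact_mod_cast Int.one_le_abs (pow_ne_zero 2 hr) |>.trans_eq (abs_of_nonneg (sq_nonneg r))
      calc (r : ℝ) ^ 2 * (((m : ℝ) / 2) ^ 2) ^ s
          ≤ ((r : ℝ) ^ 2) ^ s * (((m : ℝ) / 2) ^ 2) ^ s := by
            gcongr
            exact Real.self_le_rpow_of_one_le h1 hs
        _ = ((r : ℝ) ^ 2 * ((m : ℝ) / 2) ^ 2) ^ s :=
            (Real.mul_rpow (sq_nonneg _) (sq_nonneg _)).symm
        _ ≤ _ := by
            refine Real.rpow_le_rpow (by positivity) ?_ (by linarith)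
            linarith [sq_mul_le_modeEquiv_sq hm j r]

/-! ### Interpolation of the periodised profile -/

/-- The periodised profile on the reference interval `(-π, π)`. -/
noncomputable def scaledProfile (L θ : ℝ) : ℂ := (periodicExp L (L * θ) : ℝ)

lemma scaledProfile_continuous {L : ℝ} (hL : 0 < L) : Continuous (scaledProfile L) :=
  Complex.continuous_ofReal.comp ((periodicExp_continuous hL).comp (by fun_prop))

lemma scaledProfile_periodic {L : ℝ} (hL : 0 < L) :
    Function.Periodic (scaledProfile L) (2 * π) := fun θ => by
  rw [scaledProfile, scaledProfile, mul_add, show L * (2 * π) = 2 * π * L by ring,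
    periodicExp_periodic hL]

lemma scaledProfile_eq {L θ : ℝ} (hL : 0 < L) (hθ : θ ∈ Icc (-π) π) :
    scaledProfile L θ = (Real.exp (-(L * |θ - 0|)) : ℝ) := by
  rw [scaledProfile, periodicExp_eq_exp_neg_abs hL, sub_zero, abs_mul, abs_of_pos hL]
  rw [abs_mul, abs_of_pos hL, mul_comm]
  exact mul_le_mul_of_nonneg_right (abs_le.2 hθ) hL.le

/-- The `H¹` seminorm of the scaled profile, by Parseval's identity for its right derivative. -/
lemma tsum_sq_mul_coeff_scaledProfile_le {L : ℝ} (hL : 0 < L) :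
    ∑' k : ℤ, ENNReal.ofReal ((k : ℝ) ^ 2) * ‖coeff (scaledProfile L) k‖ₑ ^ 2 ≤
      ENNReal.ofReal (L / (2 * π)) := by
  have hpi := Real.pi_pos
  let f' : ℝ → ℂ := fun θ => (((if θ < 0 then L else -L) * Real.exp (-(L * |θ - 0|)) : ℝ) : ℂ)
  have hm : Measurable f' := by
    refine Complex.measurable_ofReal.comp (Measurable.mul ?_ (by fun_prop))
    exact Measurable.ite measurableSet_Iio measurable_const measurable_const
  have hnorm : ∀ θ, ‖f' θ‖ = L * Real.exp (-(L * |θ|)) := by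
    intro θ
    rw [Complex.norm_real, norm_mul, Real.norm_eq_abs, Real.norm_eq_abs, Real.abs_exp, sub_zero]
    split_ifs <;> simp [abs_of_pos hL]
  have hbd : ∀ θ, ‖f' θ‖ ≤ L := by
    intro θ
    rw [hnorm]
    refine mul_le_of_le_one_right hL.le (Real.exp_le_one_iff.2 ?_)
    have : 0 ≤ L * |θ| := by positivity
    linarith
  have hL2 : MemLp f' 2 (volume.restrict (Ioc (-π) π)) :=
    MemLp.of_bound hm.aestronglyMeasurable L (ae_of_all _ hbd)
  have hii : IntervalIntegrable f' volume (-π) π := by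
    rw [intervalIntegrable_iff_integrableOn_Ioc_of_le (by linarith)]
    exact hL2.integrable one_le_two
  have hcoeff : ∀ k : ℤ, ENNReal.ofReal ((k : ℝ) ^ 2) * ‖coeff (scaledProfile L) k‖ₑ ^ 2 ≤
      ‖coeff f' k‖ₑ ^ 2 := by
    intro k
    rcases eq_or_ne k 0 with rfl | hk
    · simp
    have hb : scaledProfile L π - scaledProfile L (-π) = 0 := by
      have := scaledProfile_periodic hL (-π)
      rw [show -π + 2 * π = π by ring] at this
      rw [this, sub_self]
    have h := fourierCoeffOn_of_hasDeriv_right (neg_lt_self Real.pi_pos) hk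
      (f := scaledProfile L) (f' := f') (scaledProfile_continuous hL).continuousOn ?_ hii
    · rw [hb, mul_zero, zero_sub] at h
      change coeff (scaledProfile L) k = _ * -(_ * coeff f' k) at h
      have hpi' : (π : ℂ) ≠ 0 := by exact_mod_cast hpi.ne'
      have hk' : (k : ℂ) ≠ 0 := by exact_mod_cast hk
      have h2 : (((k : ℝ) : ℂ)) * coeff (scaledProfile L) k = -Complex.I * coeff f' k := by
        rw [h]
        push_cast
        field_simp
        linear_combination ((2 : ℂ) * coeff f' k) * Complex.I_sq
      rw [← enorm_ofReal_mul_sq, h2, enorm_mul, enorm_neg, ← ofReal_norm Complex.I, Complex.norm_I,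
        ENNReal.ofReal_one, one_mul]
    · intro θ hθ
      rw [min_eq_left (by linarith), max_eq_right (by linarith)] at hθ
      refine ((hasDerivWithinAt_exp_neg_abs L 0 θ).ofReal_comp.congr_of_eventuallyEq ?_ ?_)
      · filter_upwards [mem_nhdsWithin_of_mem_nhds (Icc_mem_nhds hθ.1 hθ.2)] with q hq
        exact scaledProfile_eq hL hq
      · exact scaledProfile_eq hL (Ioo_subset_Icc_self hθ)
  have hint : ∫ θ : ℝ, L ^ 2 * Real.exp (-(2 * L) * |θ|) = L := by
    rw [integral_const_mul, integral_comp_abs (f := fun x => Real.exp (-(2 * L) * x)),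
      integral_exp_mul_Ioi (by linarith)]
    field_simp
    simp
  have hi : Integrable fun θ : ℝ => L ^ 2 * Real.exp (-(2 * L) * |θ|) :=
    Integrable.of_integral_ne_zero (by rw [hint]; exact hL.ne')
  have hle : ∫⁻ θ in Ioo (-π) π, ‖f' θ‖ₑ ^ 2 ≤ ENNReal.ofReal L := by
    refine (setLIntegral_le_lintegral _ _).trans (le_of_eq ?_)
    rw [← hint, ofReal_integral_eq_lintegral_ofReal hi (ae_of_all _ fun θ => by positivity)]
    refine lintegral_congr fun θ => ?_
    rw [← ofReal_norm, ← ENNReal.ofReal_pow (norm_nonneg _), hnorm, mul_pow, ← Real.exp_nat_mul]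
    congr 3
    push_cast
    ring
  rw [lintegral_enorm_sq_eq_tsum hL2] at hle
  refine (ENNReal.tsum_le_tsum hcoeff).trans ?_
  rw [ENNReal.ofReal_div_of_pos (by positivity), ENNReal.le_div_iff_mul_le, mul_comm]
  · exact hle
  · exact Or.inl (ENNReal.ofReal_pos.2 (by positivity)).ne'
  · exact Or.inl ENNReal.ofReal_ne_top

/-- The trigonometric interpolant of the periodised profile on `n` grid points of
`(-πL, πL)`. -/
noncomputable def profileInterp (L : ℝ) (n : ℕ) (p : ℝ) : ℂ := interp n (scaledProfile L) (p / L)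

@[fun_prop]
lemma profileInterp_continuous (L : ℝ) (n : ℕ) : Continuous (profileInterp L n) := by
  unfold profileInterp
  fun_prop

lemma profileInterp_periodic {L : ℝ} (hL : 0 < L) {n : ℕ} [NeZero n] (hn : Even n) :
    Function.Periodic (profileInterp L n) (2 * π * L) := fun p => by
  rw [profileInterp, profileInterp, add_div, mul_div_cancel_right₀ _ hL.ne', interp_periodic hn]

/-- The interpolation error of the profile is first order in `Δp = 2πL / n`, uniformly in `L`. -/
lemma lintegral_profile_sub_interp_le {L : ℝ} (hL : 0 < L) {n : ℕ} [NeZero n] (hn : Even n) :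
    ∫⁻ p in Ioo (-(π * L)) (π * L), ‖(periodicExp L p : ℂ) - profileInterp L n p‖ₑ ^ 2 ≤
      (invSqSum + 1) * ENNReal.ofReal ((2 * π * L / n) ^ 2) := by
  have hpi := Real.pi_pos
  have hn0 : (0 : ℝ) < n := by exact_mod_cast NeZero.pos n
  have himg : Ioo (-(π * L)) (π * L) = (fun θ => L * θ) '' Ioo (-π) π := by
    rw [Set.image_mul_left_Ioo hL]
    congr 1 <;> ring
  rw [himg, lintegral_image_eq_lintegral_abs_deriv_mul measurableSet_Ioo
    (f' := fun _ => L) (fun θ _ => by simpa using ((hasDerivAt_id θ).const_mul L).hasDerivWithinAt)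
    (mul_right_injective₀ hL.ne').injOn]
  have hcont : Continuous fun θ => scaledProfile L θ - interp n (scaledProfile L) θ :=
    (scaledProfile_continuous hL).sub (interp_continuous _ _)
  have h1 : ∀ θ, (periodicExp L (L * θ) : ℂ) - profileInterp L n (L * θ) =
      scaledProfile L θ - interp n (scaledProfile L) θ := fun θ => by
    rw [profileInterp, mul_div_cancel_left₀ _ hL.ne', scaledProfile]
  simp only [h1]
  rw [lintegral_const_mul _ (hcont.measurable.enorm.pow_const 2),
    lintegral_enorm_sq_eq_tsum (memLp_two_Ioc_of_continuous hcont _ _)]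
  simp only [coeff_sub (scaledProfile_continuous hL) (interp_continuous _ _)]
  have hρ0 : ENNReal.ofReal (((n : ℝ) / 2) ^ 2) ≠ 0 :=
    (ENNReal.ofReal_pos.2 (by positivity)).ne'
  have hsem := tsum_sq_mul_coeff_scaledProfile_le hL
  have hint := tsum_coeff_sub_interp_le hn (scaledProfile_continuous hL)
    (scaledProfile_periodic hL) (wt := fun k => ENNReal.ofReal ((k : ℝ) ^ 2))
    (ρ := ENNReal.ofReal (((n : ℝ) / 2) ^ 2)) (fun k => le_rfl)
    (fun j r => by
      rw [← ENNReal.ofReal_mul (sq_nonneg _)]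
      exact ENNReal.ofReal_le_ofReal (sq_mul_le_modeEquiv_sq hn j r))
    (ne_top_of_le_ne_top ENNReal.ofReal_ne_top hsem)
  rw [← ENNReal.mul_le_mul_iff_right hρ0 ENNReal.ofReal_ne_top]
  calc _ = ENNReal.ofReal |L| * ENNReal.ofReal (2 * π) * (ENNReal.ofReal (((n : ℝ) / 2) ^ 2) *
        ∑' k, ‖coeff (scaledProfile L) k - coeff (interp n (scaledProfile L)) k‖ₑ ^ 2) := by ring
    _ ≤ ENNReal.ofReal |L| * ENNReal.ofReal (2 * π) *
        ((invSqSum + 1) * ENNReal.ofReal (L / (2 * π))) := by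
        exact mul_le_mul_right (hint.trans (mul_le_mul_right hsem _)) _
    _ = (invSqSum + 1) * ENNReal.ofReal (L ^ 2) := by
        rw [mul_left_comm, abs_of_pos hL, ← ENNReal.ofReal_mul hL.le,
          ← ENNReal.ofReal_mul (by positivity)]
        congr 2
        field_simp
    _ ≤ (invSqSum + 1) * ENNReal.ofReal (((n : ℝ) / 2) ^ 2 * (2 * π * L / n) ^ 2) := by
        gcongr
        rw [← mul_pow, show (n : ℝ) / 2 * (2 * π * L / n) = π * L by field_simp]
        gcongr
        nlinarith [Real.pi_gt_three]
    _ = _ := by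
        rw [ENNReal.ofReal_mul (sq_nonneg _)]
        ring

lemma enorm_add_sq_le (a b : ℂ) : ‖a + b‖ₑ ^ 2 ≤ 2 * ‖a‖ₑ ^ 2 + 2 * ‖b‖ₑ ^ 2 := by
  have h : ‖a + b‖ ^ 2 ≤ 2 * ‖a‖ ^ 2 + 2 * ‖b‖ ^ 2 := by
    have := norm_add_le a b
    nlinarith [norm_nonneg (a + b), sq_nonneg (‖a‖ - ‖b‖), norm_nonneg a, norm_nonneg b]
  have h2 : (2 : ℝ≥0∞) = ENNReal.ofReal 2 := by simp
  simp only [← ofReal_norm]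
  rw [h2, ← ENNReal.ofReal_pow (norm_nonneg _), ← ENNReal.ofReal_pow (norm_nonneg _),
    ← ENNReal.ofReal_pow (norm_nonneg _), ← ENNReal.ofReal_mul zero_le_two,
    ← ENNReal.ofReal_mul zero_le_two, ← ENNReal.ofReal_add (by positivity) (by positivity)]
  exact ENNReal.ofReal_le_ofReal h

lemma lintegral_periodicExp_sq_le {L : ℝ} (hL : 0 < L) :
    ∫⁻ p in Ioo (-(π * L)) (π * L), ‖(periodicExp L p : ℂ)‖ₑ ^ 2 ≤ 1 := by
  have h := lintegral_profile_sq 0 1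
  simp only [sub_zero, mul_one, enorm_one, one_pow] at h
  rw [← h]
  refine le_trans (le_of_eq ?_) (setLIntegral_le_lintegral (Ioo (-(π * L)) (π * L)) _)
  refine setLIntegral_congr_fun measurableSet_Ioo fun p hp => ?_
  rw [periodicExp_eq_exp_neg_abs hL (abs_le.2 ⟨hp.1.le, hp.2.le⟩)]

lemma lintegral_profileInterp_sq_le {L : ℝ} (hL : 0 < L) {n : ℕ} [NeZero n] (hn : Even n) :
    ∫⁻ p in Ioo (-(π * L)) (π * L), ‖profileInterp L n p‖ₑ ^ 2 ≤
      2 * ((invSqSum + 1) * ENNReal.ofReal ((2 * π * L / n) ^ 2)) + 2 := by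
  have hG : Measurable fun p => (periodicExp L p : ℂ) :=
    Complex.measurable_ofReal.comp (periodicExp_continuous hL).measurable
  have hI : Measurable (profileInterp L n) := (profileInterp_continuous L n).measurable
  calc _ ≤ ∫⁻ p in Ioo (-(π * L)) (π * L), (2 * ‖(periodicExp L p : ℂ) - profileInterp L n p‖ₑ ^ 2 +
        2 * ‖(periodicExp L p : ℂ)‖ₑ ^ 2) := by
        refine lintegral_mono fun p => ?_
        have h := enorm_add_sq_le (-((periodicExp L p : ℂ) - profileInterp L n p))
          (periodicExp L p : ℂ)
        rwa [neg_sub, sub_add_cancel, enorm_sub_rev] at h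
    _ ≤ _ := by
        rw [lintegral_add_left (by fun_prop), lintegral_const_mul _ (by fun_prop),
          lintegral_const_mul _ (by fun_prop)]
        gcongr
        · exact lintegral_profile_sub_interp_le hL hn
        · exact mul_le_of_le_one_right zero_le (lintegral_periodicExp_sq_le hL)

lemma lintegral_periodic_shift {a : ℝ} (ha : 0 ≤ a) {h : ℝ → ℂ} (hc : Continuous h)
    (hp : Function.Periodic h (2 * a)) (Y : ℝ) :
    ∫⁻ p in Ioo (-a) a, ‖h (p - Y)‖ₑ ^ 2 = ∫⁻ p in Ioo (-a) a, ‖h p‖ₑ ^ 2 := by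
  have key : ∀ g : ℝ → ℂ, Continuous g → ∫⁻ p in Ioo (-a) a, ‖g p‖ₑ ^ 2 =
      ENNReal.ofReal (∫ p in (-a)..a, ‖g p‖ ^ 2) := by
    intro g hg
    rw [intervalIntegral.integral_of_le (by linarith), restrict_Ioo_eq_restrict_Ioc,
      ofReal_integral_eq_lintegral_ofReal
        (by fun_prop : Continuous fun p => ‖g p‖ ^ 2).integrableOn_Ioc
          (ae_of_all _ fun _ => by positivity)]
    refine lintegral_congr fun p => ?_
    rw [← ofReal_norm, ENNReal.ofReal_pow (norm_nonneg _)]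
  rw [key _ hc, key (fun p => h (p - Y)) (by fun_prop),
    intervalIntegral.integral_comp_sub_right (fun p => ‖h p‖ ^ 2)]
  have hp2 : Function.Periodic (fun p => ‖h p‖ ^ 2) (2 * a) := fun p => by simp only [hp p]
  have := hp2.intervalIntegral_add_eq (-a - Y) (-a)
  rw [show -a - Y + 2 * a = a - Y by ring, show -a + 2 * a = a by ring] at this
  rw [this]

/-- The error of a single mode: transport preserves the `L²` norm over a period, so that it is the
error of the tensor product interpolation of the terminal data. -/
lemma lintegral_mode_error_le {L : ℝ} (hL : 0 < L) {n : ℕ} [NeZero n] (hn : Even n) (Y : ℝ)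
    (c d : ℂ) :
    ∫⁻ p in Ioo (-(π * L)) (π * L),
        ‖(periodicExp L (p - Y) : ℂ) * c - profileInterp L n (p - Y) * d‖ₑ ^ 2 ≤
      2 * ((invSqSum + 1) * ENNReal.ofReal ((2 * π * L / n) ^ 2)) * ‖c‖ₑ ^ 2 +
        2 * (2 * ((invSqSum + 1) * ENNReal.ofReal ((2 * π * L / n) ^ 2)) + 2) * ‖c - d‖ₑ ^ 2 := by
  have hG : Continuous fun p => (periodicExp L p : ℂ) :=
    Complex.continuous_ofReal.comp (periodicExp_continuous hL)
  have hI := profileInterp_continuous L n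
  have hGm := hG.measurable
  have hIm := hI.measurable
  have hper : Function.Periodic (fun p => (periodicExp L p : ℂ) * c - profileInterp L n p * d)
      (2 * (π * L)) := fun p => by
    simp only
    rw [← mul_assoc, periodicExp_periodic hL, profileInterp_periodic hL hn]
  rw [lintegral_periodic_shift (h := fun p => (periodicExp L p : ℂ) * c - profileInterp L n p * d)
    (by positivity) (by fun_prop) hper]
  calc _ ≤ ∫⁻ p in Ioo (-(π * L)) (π * L),
        (2 * ‖c‖ₑ ^ 2 * ‖(periodicExp L p : ℂ) - profileInterp L n p‖ₑ ^ 2 +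
          2 * ‖c - d‖ₑ ^ 2 * ‖profileInterp L n p‖ₑ ^ 2) := by
        refine lintegral_mono fun p => ?_
        have h := enorm_add_sq_le (((periodicExp L p : ℂ) - profileInterp L n p) * c)
          (profileInterp L n p * (c - d))
        rw [enorm_mul, enorm_mul, mul_pow, mul_pow] at h
        refine le_trans (le_of_eq ?_) (h.trans (le_of_eq ?_))
        · congr 2
          ring
        · ring
    _ ≤ _ := by
        rw [lintegral_add_left (by fun_prop), lintegral_const_mul _ (by fun_prop),
          lintegral_const_mul _ (by fun_prop), mul_right_comm 2 (‖c‖ₑ ^ 2),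
          mul_right_comm 2 (‖c - d‖ₑ ^ 2)]
        gcongr
        · exact lintegral_profile_sub_interp_le hL hn
        · exact lintegral_profileInterp_sq_le hL hn

/-! ### The semi-discrete system -/

lemma basisP_eq {L : ℝ} (hL : 0 < L) (n : ℕ) (j : Fin n) (p : ℝ) :
    basisP L n j p = basisX n j (p / L) := by
  rw [basisP, basisX, freqP, freqX]
  congr 3
  field_simp

lemma gridP_eq {L : ℝ} (n : ℕ) (i : Fin n) : gridP L n i = L * gridX n i := by
  rw [gridP, gridX]
  ring

lemma transform_eq {L : ℝ} (hL : 0 < L) (n m : ℕ) :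
    transform L n m = gridMatrix n ⊗ₖ gridMatrix m := by
  rw [transform, gridMatrix, gridMatrix]
  congr 2
  funext i j
  rw [basisP_eq hL, gridP_eq, mul_div_cancel_left₀ _ hL.ne']

lemma symbol_eq (L : ℝ) (n m : ℕ) : symbol L n m =
    Matrix.diagonal fun j => ((freqP L n j.1 * freqX m j.2 ^ 2 : ℝ) : ℂ) := by
  rw [symbol, Matrix.diagonal_pow, Matrix.diagonal_kronecker_diagonal]
  simp

lemma kronecker_mulVec_mul {ι κ : Type*} [Fintype ι] [Fintype κ] (A : Matrix ι ι ℂ)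
    (B : Matrix κ κ ℂ) (a : ι → ℂ) (b : κ → ℂ) (j : ι × κ) :
    ((A ⊗ₖ B) *ᵥ fun i => a i.1 * b i.2) j = (A *ᵥ a) j.1 * (B *ᵥ b) j.2 := by
  simp only [Matrix.mulVec, dotProduct, Matrix.kroneckerMap_apply, Fintype.sum_prod_type,
    Finset.sum_mul_sum]
  refine Finset.sum_congr rfl fun i _ => Finset.sum_congr rfl fun i' _ => ?_
  ring

lemma transform_det_isUnit {L : ℝ} (hL : 0 < L) (n m : ℕ) : IsUnit (transform L n m).det := by
  rw [transform_eq hL, Matrix.det_kronecker]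
  exact ((gridMatrix_det_isUnit n).pow _).mul ((gridMatrix_det_isUnit m).pow _)

/-- In the modal basis the semi-discrete system is diagonal. -/
lemma IsDiscreteSolution.mode_zero_eq {T L : ℝ} (hT : 0 < T) (hL : 0 < L) {n m : ℕ} {uT : ℝ → ℂ}
    {wh : ℝ → Fin n × Fin m → ℂ} (h : IsDiscreteSolution T L n m uT wh) (j : Fin n × Fin m) :
    ((transform L n m)⁻¹ *ᵥ wh 0) j =
      Complex.exp (Complex.I * ((-(freqP L n j.1 * freqX m j.2 ^ 2 * T) : ℝ) : ℂ)) *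
        ((transform L n m)⁻¹ *ᵥ wh T) j := by
  let y : ℝ → ℂ := fun t => ((transform L n m)⁻¹ *ᵥ wh t) j
  let μ : ℂ := ((freqP L n j.1 * freqX m j.2 ^ 2 : ℝ) : ℂ)
  have hy : ∀ t ∈ Icc 0 T, HasDerivWithinAt y (Complex.I * μ * y t) (Icc 0 T) t := by
    intro t ht
    have h1 := hasDerivWithinAt_pi.1 (h.ode t ht)
    have h2 : HasDerivWithinAt y (((transform L n m)⁻¹ *ᵥ
        ((Complex.I • (transform L n m * symbol L n m * (transform L n m)⁻¹)) *ᵥ wh t)) j)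
        (Icc 0 T) t :=
      HasDerivWithinAt.fun_sum fun i _ => (h1 i).const_mul ((transform L n m)⁻¹ j i)
    refine h2.congr_deriv ?_
    rw [Matrix.mulVec_mulVec, Matrix.mul_smul, Matrix.mul_assoc,
      Matrix.nonsing_inv_mul_cancel_left _ _ (transform_det_isUnit hL n m), Matrix.smul_mulVec,
      Pi.smul_apply, ← Matrix.mulVec_mulVec, symbol_eq, Matrix.mulVec_diagonal, smul_eq_mul,
      mul_assoc]
  have he : ∀ t : ℝ, HasDerivAt (fun t : ℝ => Complex.exp (-(Complex.I * μ) * (t : ℂ)))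
      (Complex.exp (-(Complex.I * μ) * (t : ℂ)) * -(Complex.I * μ)) t := by
    intro t
    have := ((hasDerivAt_id t).ofReal_comp.const_mul (-(Complex.I * μ))).cexp
    simpa using this
  have hg : ∀ t ∈ Icc 0 T, HasDerivWithinAt
      (fun t : ℝ => y t * Complex.exp (-(Complex.I * μ) * (t : ℂ))) 0 (Icc 0 T) t := by
    intro t ht
    refine ((hy t ht).mul (he t).hasDerivWithinAt).congr_deriv ?_
    ring
  have hc := constant_of_derivWithin_zero (fun t ht => (hg t ht).differentiableWithinAt)
    (fun t ht => (hg t (Ico_subset_Icc_self ht)).derivWithin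
      ((uniqueDiffOn_Icc hT) t (Ico_subset_Icc_self ht))) T ⟨hT.le, le_rfl⟩
  simp only [Complex.ofReal_zero, mul_zero, Complex.exp_zero, mul_one] at hc
  change y 0 = _ * y T
  rw [← hc, mul_comm]
  congr 2
  simp only [μ]
  push_cast
  ring

lemma abs_gridP_le {L : ℝ} (hL : 0 < L) {n : ℕ} (i : Fin n) : |gridP L n i| ≤ π * L := by
  have hpi := Real.pi_pos
  have hn : (0 : ℝ) < n := by exact_mod_cast i.pos
  have hi : ((i : ℕ) : ℝ) ≤ n := by exact_mod_cast i.2.le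
  have h1 : ((i : ℕ) : ℝ) * (2 * π * L / n) ≤ 2 * π * L := by
    rw [mul_div_assoc', div_le_iff₀ hn, mul_comm]
    gcongr
  have h0 : 0 ≤ ((i : ℕ) : ℝ) * (2 * π * L / n) := by positivity
  rw [gridP, abs_le]
  constructor <;> linarith

/-- The computed solution transports the interpolated profile with speed `k²` in each resolved
frequency `k`. -/
lemma IsDiscreteSolution.coeff_reconstruct {T L : ℝ} (hT : 0 < T) (hL : 0 < L) {n m : ℕ}
    [NeZero m] (hm : Even m) {uT : ℝ → ℂ}
    {wh : ℝ → Fin n × Fin m → ℂ} (h : IsDiscreteSolution T L n m uT wh) (p : ℝ) (k : ℤ) :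
    coeff (fun x => reconstruct L n m (wh 0) x p) k =
      profileInterp L n (p - (k : ℝ) ^ 2 * T) * coeff (interp m uT) k := by
  have hterm : ∀ j : Fin n × Fin m, ((transform L n m)⁻¹ *ᵥ wh T) j =
      interpCoeff n (scaledProfile L) j.1 * interpCoeff m uT j.2 := by
    intro j
    have : wh T = fun i => scaledProfile L (gridX n i.1) * uT (gridX m i.2) := by
      funext i
      rw [h.terminal, scaledProfile, ← gridP_eq, periodicExp_eq_exp_neg_abs hL (abs_gridP_le hL _)]
    rw [this, transform_eq hL, Matrix.inv_kronecker, kronecker_mulVec_mul _ _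
      (fun i => scaledProfile L (gridX n i)) (fun i => uT (gridX m i))]
    rfl
  have hrec : ∀ x, reconstruct L n m (wh 0) x p = ∑ l, interpCoeff m uT l *
      (profileInterp L n (p - freqX m l ^ 2 * T) * basisX m l x) := by
    intro x
    rw [reconstruct, Fintype.sum_prod_type_right]
    refine Finset.sum_congr rfl fun l _ => ?_
    rw [profileInterp, interp, Finset.sum_mul, Finset.mul_sum]
    refine Finset.sum_congr rfl fun j _ => ?_
    have hshift : Complex.exp (Complex.I * ((-(freqP L n j * freqX m l ^ 2 * T) : ℝ) : ℂ)) *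
        basisP L n j p = basisX n j ((p - freqX m l ^ 2 * T) / L) := by
      rw [← basisP_eq hL, basisP, basisP, ← Complex.exp_add]
      congr 1
      push_cast
      ring
    rw [h.mode_zero_eq hT hL, hterm, ← hshift]
    ring
  simp only [hrec]
  rw [coeff_finsetSum _ _ fun l => by fun_prop]
  rw [show interp m uT = fun x => ∑ l, interpCoeff m uT l * basisX m l x from rfl,
    coeff_finsetSum _ _ fun l => by fun_prop, Finset.mul_sum]
  refine Finset.sum_congr rfl fun l _ => ?_
  simp only [coeff_const_mul]
  by_cases hl : modeEquiv m (l, 0) = k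
  · have hk : freqX m l = (k : ℝ) := by
      rw [← hl, cast_modeEquiv hm]
      simp
    rw [hk]
    ring
  · rw [coeff_basisX hm, if_neg hl]
    ring

/-! ### The error of the recovered solution -/

/-- The transported profile recovers `û_0(k)` exactly for `p ≥ k²T`. On `p > η²T` an error remains
only in the frequencies above `η`, where it is at most `|û_0(k)|`. -/
lemma enorm_recovery_sq_le {T η : ℝ} (hT : 0 < T) {u : ℝ → ℝ → ℂ} (hu : IsHeatSolution T u)
    (k : ℤ) {p : ℝ} (hp : η ^ 2 * T < p) :
    ‖coeff (u 0) k - (Real.exp p : ℂ) *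
        ((Real.exp (-|p - (k : ℝ) ^ 2 * T|) : ℂ) * coeff (u T) k)‖ₑ ^ 2 ≤
      if η < |(k : ℝ)| then ‖coeff (u 0) k‖ₑ ^ 2 else 0 := by
  have hX : coeff (u 0) k - (Real.exp p : ℂ) *
      ((Real.exp (-|p - (k : ℝ) ^ 2 * T|) : ℂ) * coeff (u T) k) =
      ((1 - Real.exp (p - (k : ℝ) ^ 2 * T - |p - (k : ℝ) ^ 2 * T|) : ℝ) : ℂ) * coeff (u 0) k := by
    rw [hu.coeff_eq ⟨hT.le, le_rfl⟩ k, ← mul_assoc, ← mul_assoc, ← Complex.ofReal_mul,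
      ← Complex.ofReal_mul, ← Real.exp_add, ← Real.exp_add,
      show p + -|p - (k : ℝ) ^ 2 * T| + -((k : ℝ) ^ 2 * T) =
        p - (k : ℝ) ^ 2 * T - |p - (k : ℝ) ^ 2 * T| by ring]
    push_cast
    ring
  rw [hX, enorm_ofReal_mul_sq]
  split_ifs with hk
  · refine mul_le_of_le_one_left zero_le ?_
    rw [ENNReal.ofReal_le_one]
    have h1 := Real.exp_pos (p - (k : ℝ) ^ 2 * T - |p - (k : ℝ) ^ 2 * T|)
    have h2 : Real.exp (p - (k : ℝ) ^ 2 * T - |p - (k : ℝ) ^ 2 * T|) ≤ 1 :=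
      Real.exp_le_one_iff.2 (sub_nonpos.2 (le_abs_self _))
    nlinarith
  · have hk2 : (k : ℝ) ^ 2 ≤ η ^ 2 := by
      rw [← sq_abs]
      exact pow_le_pow_left₀ (abs_nonneg _) (not_lt.1 hk) 2
    have hkp : (k : ℝ) ^ 2 * T ≤ p := (mul_le_mul_of_nonneg_right hk2 hT.le).trans hp.le
    rw [abs_of_nonneg (sub_nonneg.2 hkp), sub_self, Real.exp_zero, sub_self]
    simp

lemma enorm_exp_mul_sq_le {p q : ℝ} (hpq : p ≤ q) (z : ℂ) :
    ‖(Real.exp p : ℂ) * z‖ₑ ^ 2 ≤ ENNReal.ofReal (Real.exp q ^ 2) * ‖z‖ₑ ^ 2 := by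
  rw [enorm_ofReal_mul_sq]
  gcongr

/-- The error in one frequency: recovery from the whole-line solution, periodisation, and
discretization. -/
lemma lintegral_mode_recovery_le {T L η ℓ : ℝ} (hT : 0 < T) (hL : 0 < L)
    (hℓ1 : ℓ ≤ π * L - η ^ 2 * T) {u : ℝ → ℝ → ℂ}
    (hu : IsHeatSolution T u) {n : ℕ} [NeZero n] (hn : Even n) (k : ℤ) (d : ℂ) :
    ∫⁻ p in Ioo (η ^ 2 * T) (η ^ 2 * T + ℓ), ‖coeff (u 0) k -
        (Real.exp p : ℂ) * (profileInterp L n (p - (k : ℝ) ^ 2 * T) * d)‖ₑ ^ 2 ≤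
      2 * (ENNReal.ofReal ℓ * if η < |(k : ℝ)| then ‖coeff (u 0) k‖ₑ ^ 2 else 0) +
      4 * ENNReal.ofReal (Real.exp (η ^ 2 * T + ℓ) ^ 2) *
        (ENNReal.ofReal (1 / 2 * Real.exp (2 * ((k : ℝ) ^ 2 * T) - 2 * (π * L))) *
            ‖coeff (u T) k‖ₑ ^ 2 +
          (2 * ((invSqSum + 1) * ENNReal.ofReal ((2 * π * L / n) ^ 2)) * ‖coeff (u T) k‖ₑ ^ 2 +
            2 * (2 * ((invSqSum + 1) * ENNReal.ofReal ((2 * π * L / n) ^ 2)) + 2) *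
              ‖coeff (u T) k - d‖ₑ ^ 2)) := by
  have ha : 0 ≤ η ^ 2 * T := by positivity
  have hP : 0 < π * L := by positivity
  set Y := (k : ℝ) ^ 2 * T with hY
  set E := ENNReal.ofReal (Real.exp (η ^ 2 * T + ℓ) ^ 2) with hE
  set c := coeff (u T) k with hc
  have hsub : Ioo (η ^ 2 * T) (η ^ 2 * T + ℓ) ⊆ Ioo (-(π * L)) (π * L) :=
    Ioo_subset_Ioo (by linarith) (by linarith)
  have hGm : Measurable fun p => periodicExp L (p - Y) :=
    (periodicExp_continuous hL).measurable.comp (by fun_prop)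
  have hIm : Measurable fun p => profileInterp L n (p - Y) :=
    (profileInterp_continuous L n).measurable.comp (by fun_prop)
  calc _ ≤ ∫⁻ p in Ioo (η ^ 2 * T) (η ^ 2 * T + ℓ),
        (2 * (if η < |(k : ℝ)| then ‖coeff (u 0) k‖ₑ ^ 2 else 0) +
          4 * E * (ENNReal.ofReal ((periodicExp L (p - Y) - Real.exp (-|p - Y|)) ^ 2) *
              ‖c‖ₑ ^ 2 +
            ‖(periodicExp L (p - Y) : ℂ) * c - profileInterp L n (p - Y) * d‖ₑ ^ 2)) := by
        refine setLIntegral_mono' measurableSet_Ioo fun p hp => ?_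
        have hX := enorm_recovery_sq_le (η := η) hT hu k hp.1
        rw [← hY, ← hc] at hX
        have hB := enorm_exp_mul_sq_le hp.2.le
          (((Real.exp (-|p - Y|) - periodicExp L (p - Y) : ℝ) : ℂ) * c)
        rw [enorm_ofReal_mul_sq (Real.exp (-|p - Y|) - _), sub_sq_comm, ← hE] at hB
        have hZ := enorm_exp_mul_sq_le hp.2.le
          ((periodicExp L (p - Y) : ℂ) * c - profileInterp L n (p - Y) * d)
        rw [← hE] at hZ
        set x := coeff (u 0) k - (Real.exp p : ℂ) * ((Real.exp (-|p - Y|) : ℂ) * c)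
        set y := (Real.exp p : ℂ) * (((Real.exp (-|p - Y|) - periodicExp L (p - Y) : ℝ) : ℂ) * c)
          with hy
        set z := (Real.exp p : ℂ) *
          ((periodicExp L (p - Y) : ℂ) * c - profileInterp L n (p - Y) * d)
        have hsum : coeff (u 0) k - (Real.exp p : ℂ) * (profileInterp L n (p - Y) * d) =
            x + (y + z) := by
          simp only [x, hy, z]
          push_cast
          ring
        rw [hsum]
        calc _ ≤ 2 * ‖x‖ₑ ^ 2 + 2 * (2 * ‖y‖ₑ ^ 2 + 2 * ‖z‖ₑ ^ 2) :=
              (enorm_add_sq_le x (y + z)).trans (by gcongr; exact enorm_add_sq_le y z)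
          _ ≤ 2 * (if η < |(k : ℝ)| then ‖coeff (u 0) k‖ₑ ^ 2 else 0) +
              2 * (2 * (E * (ENNReal.ofReal ((periodicExp L (p - Y) - Real.exp (-|p - Y|)) ^ 2) *
                ‖c‖ₑ ^ 2)) + 2 * (E *
                ‖(periodicExp L (p - Y) : ℂ) * c - profileInterp L n (p - Y) * d‖ₑ ^ 2)) := by
              gcongr
          _ = _ := by ring
    _ ≤ _ := by
        rw [lintegral_add_left (by fun_prop), lintegral_const, Measure.restrict_apply_univ,
          Real.volume_Ioo, add_sub_cancel_left, lintegral_const_mul _ (by fun_prop),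
          lintegral_add_left (by fun_prop), lintegral_mul_const _ (by fun_prop)]
        refine add_le_add (le_of_eq (by ring)) ?_
        gcongr
        · exact (lintegral_mono_set hsub).trans (lintegral_defect_le hL (by positivity))
        · exact (lintegral_mono_set hsub).trans (lintegral_mode_error_le hL hn Y c d)

/-- The constant in the square of the error estimate for the recovered solution. -/
noncomputable def errorConst (s K : ℝ) : ℝ :=
  8 * (2 + 2 * K ^ 2 + 24 * (invSqSum + 1).toReal + 16 * (invSqSum + 1).toReal ^ 2 * (π ^ s) ^ 2)

lemma two_le_errorConst (s K : ℝ) : 2 ≤ errorConst s K := by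
  have h1 : 0 ≤ (invSqSum + 1).toReal := ENNReal.toReal_nonneg
  have h2 : 0 ≤ 16 * (invSqSum + 1).toReal ^ 2 * (π ^ s) ^ 2 := by positivity
  rw [errorConst]
  nlinarith [sq_nonneg K]

lemma tsum_coeff_sub_interp_le_gridWidth {m : ℕ} [NeZero m] (hm : Even m) {f : ℝ → ℂ}
    (hf : Continuous f) (hp : Function.Periodic f (2 * π)) {s : ℝ} (hs : 1 ≤ s)
    (hfin : ∑' k : ℤ, ENNReal.ofReal ((1 + (k : ℝ) ^ 2) ^ s) * ‖coeff f k‖ₑ ^ 2 ≠ ⊤) :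
    ∑' k, ‖coeff f k - coeff (interp m f) k‖ₑ ^ 2 ≤
      (invSqSum + 1) * ENNReal.ofReal (((2 * π / m) ^ s) ^ 2) *
        ∑' k : ℤ, ENNReal.ofReal ((1 + (k : ℝ) ^ 2) ^ s) * ‖coeff f k‖ₑ ^ 2 := by
  have hm0 : (0 : ℝ) < m := by exact_mod_cast NeZero.pos m
  have h0 : ENNReal.ofReal ((((m : ℝ) / 2) ^ 2) ^ s) ≠ 0 :=
    (ENNReal.ofReal_pos.2 (by positivity)).ne'
  rw [← ENNReal.mul_le_mul_iff_right h0 ENNReal.ofReal_ne_top]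
  refine (tsum_coeff_sub_interp_le_sobolev hm hf hp hs hfin).trans ?_
  have h1 : 1 ≤ ENNReal.ofReal ((((m : ℝ) / 2) ^ 2) ^ s) *
      ENNReal.ofReal (((2 * π / m) ^ s) ^ 2) := by
    rw [← ENNReal.ofReal_mul (by positivity), ENNReal.one_le_ofReal,
      ← Real.rpow_natCast ((2 * π / m) ^ s), ← Real.rpow_mul (by positivity), mul_comm s,
      Real.rpow_mul (by positivity), Real.rpow_natCast, ← Real.mul_rpow (by positivity)
      (by positivity), ← mul_pow, show (m : ℝ) / 2 * (2 * π / m) = π by field_simp]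
    exact Real.one_le_rpow (by nlinarith [Real.pi_gt_three]) (by linarith)
  calc _ = 1 * ((invSqSum + 1) *
        ∑' k : ℤ, ENNReal.ofReal ((1 + (k : ℝ) ^ 2) ^ s) * ‖coeff f k‖ₑ ^ 2) := (one_mul _).symm
    _ ≤ _ := mul_le_mul_left h1 _
    _ = _ := by ring

/-- The square of the error of the recovered solution. The hypothesis on `e^{-(πL - 9/2 η²T)}`
controls the periodisation error amplified by `e^p ≤ e^{3/2 η²T}`. -/
lemma boxL2Norm_recovered_sq_le {T L s η ε K ℓ : ℝ} (hT : 0 < T) (hL : 0 < L) (hs : 1 ≤ s)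
    (hη : 0 < η) (hε : 0 < ε) (hK : 0 ≤ K) (hℓ0 : 0 ≤ ℓ) (hℓ1 : ℓ ≤ π * L - η ^ 2 * T)
    (hℓ2 : ℓ ≤ 1 / 2 * η ^ 2 * T) {u : ℝ → ℝ → ℂ} {w : ℝ → ℝ → ℝ → ℂ} (hu : IsHeatSolution T u)
    (hw : IsSchrodingerisedSolution T (fun p => Real.exp (-|p|)) (u T) w)
    (h0 : sobolevNorm s (u 0) < ⊤)
    (h : (tailNorm s η (u 0) / ENNReal.ofReal ε) ^ (1 / s) ≤ ENNReal.ofReal η)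
    (hKε : ENNReal.ofReal (Real.exp (-(π * L - 4.5 * η ^ 2 * T))) * sobolevNorm 0 (u T) ≤
      ENNReal.ofReal (K * ε))
    {n m : ℕ} [NeZero n] (hn : Even n) [NeZero m] (hm : Even m) {wh : ℝ → Fin n × Fin m → ℂ}
    (hwh : IsDiscreteSolution T L n m (u T) wh) :
    boxL2Norm (η ^ 2 * T) (η ^ 2 * T + ℓ)
        (fun x p => u 0 x - (Real.exp p : ℂ) * reconstruct L n m (wh 0) x p) ^ 2 ≤
      ENNReal.ofReal (errorConst s K) *
        ((ENNReal.ofReal ((2 * π * L / n + (2 * π / m) ^ s) * Real.exp (η ^ 2 * T + ℓ)) *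
            mixedNorm s (w 0)) ^ 2 +
          (ENNReal.ofReal ℓ * ∑' k : ℤ, (if η < |(k : ℝ)| then ‖coeff (u 0) k‖ₑ ^ 2 else 0) +
            ENNReal.ofReal (ε ^ 2))) := by
  have hpi := Real.pi_pos
  have hcu : ∀ t ∈ Icc 0 T, Continuous (u t) := fun t ht =>
    hu.continuousOn.comp_continuous (f := fun x : ℝ => (t, x)) (by fun_prop) fun _ => ⟨ht, trivial⟩
  have hu0 := hcu 0 ⟨le_rfl, hT.le⟩
  have huT := hcu T ⟨hT.le, le_rfl⟩
  have hcr : Continuous fun q : ℝ × ℝ => reconstruct L n m (wh 0) q.1 q.2 := by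
    unfold reconstruct
    refine continuous_finsetSum _ fun j _ => ?_
    simp only [basisP_eq hL]
    fun_prop
  rw [boxL2Norm_sq_eq_tsum (F := fun x p => u 0 x - (Real.exp p : ℂ) *
    reconstruct L n m (wh 0) x p) _ _ (by fun_prop)]
  have hmode : ∀ (k : ℤ) p, coeff (fun x => u 0 x - (Real.exp p : ℂ) *
      reconstruct L n m (wh 0) x p) k = coeff (u 0) k - (Real.exp p : ℂ) *
        (profileInterp L n (p - (k : ℝ) ^ 2 * T) * coeff (interp m (u T)) k) := by
    intro k p
    have : Continuous fun x => reconstruct L n m (wh 0) x p :=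
      hcr.comp (f := fun x : ℝ => (x, p)) (by fun_prop)
    rw [coeff_sub hu0 (by fun_prop), coeff_const_mul, hwh.coeff_reconstruct hT hL hm]
  simp only [hmode]
  set S : ℝ≥0∞ := ∑' k : ℤ, ENNReal.ofReal ((1 + (k : ℝ) ^ 2) ^ s) * ‖coeff (u T) k‖ₑ ^ 2 with hS
  set M := mixedNorm s (w 0) with hM
  have hSM : S ≤ M ^ 2 := tsum_le_mixedNorm_sq hT hw
  have hStop : S ≠ ⊤ :=
    ne_top_of_le_ne_top (ENNReal.pow_ne_top (mixedNorm_lt_top hT hu hw h0).ne) hSM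
  have hS0 : ∑' k : ℤ, ‖coeff (u T) k‖ₑ ^ 2 ≤ M ^ 2 := by
    refine le_trans (ENNReal.tsum_le_tsum fun k => ?_) hSM
    refine le_mul_of_one_le_left zero_le (ENNReal.one_le_ofReal.2 ?_)
    exact Real.one_le_rpow (by nlinarith [sq_nonneg (k : ℝ)]) (by linarith)
  have hint := (tsum_coeff_sub_interp_le_gridWidth hm huT (hu.periodic T ⟨hT.le, le_rfl⟩) hs
    hStop).trans (mul_le_mul_right hSM _)
  have hdef := tsum_defect_le (L := L) hT (by linarith : 0 < s) hη hε hu h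
  set tail := ∑' k : ℤ, (if η < |(k : ℝ)| then ‖coeff (u 0) k‖ₑ ^ 2 else 0) with htail
  obtain ⟨κ, hκ0, hκ⟩ : ∃ κ : ℝ, 0 ≤ κ ∧ invSqSum + 1 = ENNReal.ofReal κ :=
    ⟨_, ENNReal.toReal_nonneg, (ENNReal.ofReal_toReal
      (ENNReal.add_ne_top.2 ⟨invSqSum_ne_top, ENNReal.one_ne_top⟩)).symm⟩
  have hconst : errorConst s K = 8 * (2 + 2 * K ^ 2 + 24 * κ + 16 * κ ^ 2 * (π ^ s) ^ 2) := by
    rw [errorConst, hκ, ENNReal.toReal_ofReal hκ0]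
  set E : ℝ := Real.exp (η ^ 2 * T + ℓ) with hE
  have hE0 : 0 < E := Real.exp_pos _
  set δp : ℝ := 2 * π * L / n with hδp
  set δx : ℝ := (2 * π / m) ^ s with hδx
  have hδp0 : 0 ≤ δp := by positivity
  have hδx0 : 0 ≤ δx := by positivity
  have hδxπ : δx ^ 2 ≤ (π ^ s) ^ 2 := by
    -- An even positive `m` is at least `2`.
    have hm2 : (2 : ℝ) ≤ m := by
      have h1 := NeZero.pos m
      obtain ⟨r, hr⟩ := hm
      exact_mod_cast (by lia : 2 ≤ m)
    have h2 : 2 * π / m ≤ π := by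
      rw [div_le_iff₀ (by linarith)]
      nlinarith
    exact pow_le_pow_left₀ hδx0 (Real.rpow_le_rpow (by positivity) h2 (by linarith)) 2
  -- The periodisation error.
  have hper : ENNReal.ofReal (E ^ 2) * ∑' k : ℤ,
      ENNReal.ofReal (1 / 2 * Real.exp (2 * ((k : ℝ) ^ 2 * T) - 2 * (π * L))) *
        ‖coeff (u T) k‖ₑ ^ 2 ≤ ENNReal.ofReal ((K ^ 2 / 2 + 1 / 2) * ε ^ 2) := by
    have hK2 := pow_le_pow_left₀ zero_le hKε 2
    rw [mul_pow, ← ENNReal.ofReal_pow (Real.exp_nonneg _),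
      ← ENNReal.ofReal_pow (by positivity)] at hK2
    have hE2 : E ^ 2 = Real.exp (2 * (η ^ 2 * T + ℓ)) := by
      rw [hE, ← Real.exp_nat_mul, Nat.cast_ofNat]
    have hlow : E ^ 2 * (1 / 2 * Real.exp (2 * (η ^ 2 * T) - 2 * (π * L))) ≤
        1 / 2 * Real.exp (-(π * L - 4.5 * η ^ 2 * T)) ^ 2 := by
      have ha : 0 ≤ η ^ 2 * T := by positivity
      rw [hE2, mul_left_comm, ← Real.exp_add, ← Real.exp_nat_mul, Nat.cast_ofNat]
      gcongr
      linarith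
    have hhigh : E ^ 2 * (1 / 2 * Real.exp (-(2 * (π * L))) * ε ^ 2) ≤ 1 / 2 * ε ^ 2 := by
      have h1 : E ^ 2 * Real.exp (-(2 * (π * L))) ≤ 1 := by
        rw [hE2, ← Real.exp_add, Real.exp_le_one_iff]
        linarith
      nlinarith [sq_nonneg ε]
    calc _ ≤ ENNReal.ofReal (E ^ 2) * (ENNReal.ofReal
          (1 / 2 * Real.exp (2 * (η ^ 2 * T) - 2 * (π * L))) * sobolevNorm 0 (u T) ^ 2 +
            ENNReal.ofReal (1 / 2 * Real.exp (-(2 * (π * L))) * ε ^ 2)) :=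
          mul_le_mul_right hdef _
      _ ≤ ENNReal.ofReal (1 / 2) * (ENNReal.ofReal
          (Real.exp (-(π * L - 4.5 * η ^ 2 * T)) ^ 2) * sobolevNorm 0 (u T) ^ 2) +
            ENNReal.ofReal (1 / 2 * ε ^ 2) := by
          rw [mul_add, ← mul_assoc, ← mul_assoc (ENNReal.ofReal (1 / 2)),
            ← ENNReal.ofReal_mul (sq_nonneg _), ← ENNReal.ofReal_mul (sq_nonneg _),
            ← ENNReal.ofReal_mul (by norm_num)]
          gcongr ENNReal.ofReal ?_ * _ + ENNReal.ofReal ?_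
      _ ≤ ENNReal.ofReal (1 / 2) * ENNReal.ofReal ((K * ε) ^ 2) +
            ENNReal.ofReal (1 / 2 * ε ^ 2) := by gcongr
      _ = _ := by
          rw [← ENNReal.ofReal_mul (by norm_num), ← ENNReal.ofReal_add (by positivity)
            (by positivity)]
          congr 1
          ring
  rw [hκ] at hint
  calc _ ≤ ENNReal.ofReal (2 * π) * (2 * (ENNReal.ofReal ℓ * tail) +
        4 * ENNReal.ofReal (E ^ 2) * ((∑' k : ℤ,
            ENNReal.ofReal (1 / 2 * Real.exp (2 * ((k : ℝ) ^ 2 * T) - 2 * (π * L))) *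
              ‖coeff (u T) k‖ₑ ^ 2) +
          (2 * (ENNReal.ofReal κ * ENNReal.ofReal (δp ^ 2)) * ∑' k : ℤ, ‖coeff (u T) k‖ₑ ^ 2 +
            2 * (2 * (ENNReal.ofReal κ * ENNReal.ofReal (δp ^ 2)) + 2) *
              ∑' k : ℤ, ‖coeff (u T) k - coeff (interp m (u T)) k‖ₑ ^ 2))) := by
        refine mul_le_mul_right ((ENNReal.tsum_le_tsum fun k =>
          lintegral_mode_recovery_le hT hL hℓ1 hu hn k _).trans (le_of_eq ?_)) _
        rw [ENNReal.tsum_add, ENNReal.tsum_mul_left, ENNReal.tsum_mul_left, ENNReal.tsum_mul_left,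
          ENNReal.tsum_add, ENNReal.tsum_add, ENNReal.tsum_mul_left, ENNReal.tsum_mul_left, hκ]
    _ = ENNReal.ofReal (2 * π) * (2 * (ENNReal.ofReal ℓ * tail) +
        4 * (ENNReal.ofReal (E ^ 2) * ∑' k : ℤ,
            ENNReal.ofReal (1 / 2 * Real.exp (2 * ((k : ℝ) ^ 2 * T) - 2 * (π * L))) *
              ‖coeff (u T) k‖ₑ ^ 2) + 4 * ENNReal.ofReal (E ^ 2) *
          (2 * (ENNReal.ofReal κ * ENNReal.ofReal (δp ^ 2)) * ∑' k : ℤ, ‖coeff (u T) k‖ₑ ^ 2 +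
            2 * (2 * (ENNReal.ofReal κ * ENNReal.ofReal (δp ^ 2)) + 2) *
              ∑' k : ℤ, ‖coeff (u T) k - coeff (interp m (u T)) k‖ₑ ^ 2)) := by ring
    _ ≤ ENNReal.ofReal (2 * π) * (2 * (ENNReal.ofReal ℓ * tail) +
        4 * ENNReal.ofReal ((K ^ 2 / 2 + 1 / 2) * ε ^ 2) + 4 * ENNReal.ofReal (E ^ 2) *
          (2 * (ENNReal.ofReal κ * ENNReal.ofReal (δp ^ 2)) * M ^ 2 +
            2 * (2 * (ENNReal.ofReal κ * ENNReal.ofReal (δp ^ 2)) + 2) *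
              (ENNReal.ofReal κ * ENNReal.ofReal (δx ^ 2) * M ^ 2))) := by
        gcongr
    _ = ENNReal.ofReal (2 * π * 2) * (ENNReal.ofReal ℓ * tail) +
          ENNReal.ofReal (2 * π * (2 * K ^ 2 + 2)) * ENNReal.ofReal (ε ^ 2) +
          ENNReal.ofReal (2 * π * (E ^ 2 * (8 * κ * δp ^ 2 + 16 * κ ^ 2 * δp ^ 2 * δx ^ 2 +
            16 * κ * δx ^ 2))) * M ^ 2 := by
        have h2 : (2 : ℝ≥0∞) = ENNReal.ofReal 2 := by simp
        have h4 : (4 : ℝ≥0∞) = ENNReal.ofReal 4 := by simp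
        have e1 : ENNReal.ofReal (2 * π * 2) = ENNReal.ofReal (2 * π) * 2 := by
          rw [ENNReal.ofReal_mul (by positivity), ← h2]
        have e2 : ENNReal.ofReal (2 * π * (2 * K ^ 2 + 2)) * ENNReal.ofReal (ε ^ 2) =
            ENNReal.ofReal (2 * π) * (4 * ENNReal.ofReal ((K ^ 2 / 2 + 1 / 2) * ε ^ 2)) := by
          rw [h4, ← ENNReal.ofReal_mul (by positivity), ← ENNReal.ofReal_mul (by positivity),
            ← ENNReal.ofReal_mul (by positivity)]
          congr 1
          ring
        have e3 : ENNReal.ofReal (2 * π * (E ^ 2 * (8 * κ * δp ^ 2 +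
            16 * κ ^ 2 * δp ^ 2 * δx ^ 2 + 16 * κ * δx ^ 2))) = ENNReal.ofReal (2 * π) *
            (4 * ENNReal.ofReal (E ^ 2) * (2 * (ENNReal.ofReal κ * ENNReal.ofReal (δp ^ 2)) +
              2 * (2 * (ENNReal.ofReal κ * ENNReal.ofReal (δp ^ 2)) + 2) *
              (ENNReal.ofReal κ * ENNReal.ofReal (δx ^ 2)))) := by
          rw [h2, h4, ← ENNReal.ofReal_mul hκ0, ← ENNReal.ofReal_mul hκ0,
            ← ENNReal.ofReal_mul zero_le_two,
            ← ENNReal.ofReal_add (by positivity) zero_le_two,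
            ← ENNReal.ofReal_mul zero_le_two, ← ENNReal.ofReal_mul (by positivity),
            ← ENNReal.ofReal_mul (by positivity),
            ← ENNReal.ofReal_add (by positivity) (by positivity),
            ← ENNReal.ofReal_mul (by positivity), ← ENNReal.ofReal_mul (by positivity)]
          congr 1
          ring
        rw [e1, e2, e3]
        ring
    _ ≤ ENNReal.ofReal (errorConst s K) * (ENNReal.ofReal ℓ * tail) +
          ENNReal.ofReal (errorConst s K) * ENNReal.ofReal (ε ^ 2) +
          ENNReal.ofReal (errorConst s K * ((δp + δx) * E) ^ 2) * M ^ 2 := by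
        have hpi4 := Real.pi_le_four
        have hq : 0 ≤ κ ^ 2 * (π ^ s) ^ 2 := by positivity
        have hK2 := sq_nonneg K
        have c1 : 2 * π * 2 ≤ errorConst s K := by
          rw [hconst]
          linarith
        have c2 : 2 * π * (2 * K ^ 2 + 2) ≤ errorConst s K := by
          rw [hconst]
          nlinarith
        have c3 : 2 * π * (E ^ 2 * (8 * κ * δp ^ 2 + 16 * κ ^ 2 * δp ^ 2 * δx ^ 2 +
            16 * κ * δx ^ 2)) ≤ errorConst s K * ((δp + δx) * E) ^ 2 := by
          have hb : 8 * κ * δp ^ 2 + 16 * κ ^ 2 * δp ^ 2 * δx ^ 2 + 16 * κ * δx ^ 2 ≤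
              (24 * κ + 16 * κ ^ 2 * (π ^ s) ^ 2) * (δp + δx) ^ 2 := by
            have b1 : κ ^ 2 * δp ^ 2 * δx ^ 2 ≤ κ ^ 2 * δp ^ 2 * (π ^ s) ^ 2 := by gcongr
            have b2 : δp ^ 2 ≤ (δp + δx) ^ 2 := by gcongr; linarith
            have b3 : δx ^ 2 ≤ (δp + δx) ^ 2 := by gcongr; linarith
            have b4 := mul_le_mul_of_nonneg_left b2 hκ0
            have b5 := mul_le_mul_of_nonneg_left b3 hκ0
            have b6 := mul_le_mul_of_nonneg_left b2 hq
            linarith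
          calc _ ≤ 8 * (E ^ 2 * ((24 * κ + 16 * κ ^ 2 * (π ^ s) ^ 2) * (δp + δx) ^ 2)) := by
                gcongr
                linarith
            _ = (8 * (24 * κ + 16 * κ ^ 2 * (π ^ s) ^ 2)) * ((δp + δx) * E) ^ 2 := by ring
            _ ≤ _ := by
                rw [hconst]
                gcongr
                linarith
        gcongr
    _ = _ := by
        rw [ENNReal.ofReal_mul ((by norm_num : (0 : ℝ) ≤ 2).trans (two_le_errorConst s K)),
          ENNReal.ofReal_pow (by positivity : 0 ≤ (δp + δx) * E)]
        ring

lemma le_ofReal_mul_add_of_sq_le {c : ℝ} (hc : 1 ≤ c) {b x y z : ℝ≥0∞}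
    (h : b ^ 2 ≤ ENNReal.ofReal c * (x ^ 2 + y)) (hy : y ≤ z ^ 2) :
    b ≤ ENNReal.ofReal c * (x + z) := by
  rw [← ENNReal.pow_le_pow_left_iff two_ne_zero, mul_pow]
  refine h.trans (mul_le_mul' ?_ ((add_le_add_right hy _).trans (ennreal_sq_add_sq_le x z)))
  rw [← ENNReal.ofReal_pow (by linarith)]
  exact ENNReal.ofReal_le_ofReal (by nlinarith)

lemma boxL2Norm_eq_zero_of_le {a b : ℝ} (h : b ≤ a) (F : ℝ → ℝ → ℂ) : boxL2Norm a b F = 0 := by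
  rw [boxL2Norm, Ioo_eq_empty (not_lt.2 h), prod_empty, Measure.restrict_empty,
    eLpNorm_measure_zero]

end BackwardHeat

open BackwardHeat
theorem mainTheorem4 (s : ℝ) (hs : 1 ≤ s) (K : ℝ) (hK : 0 ≤ K) :
    ∃ C : ℝ, 0 < C ∧
      ∀ (T L ηmax ε : ℝ), 0 < T → 0 < L → 0 < ηmax → 0 < ε →
      ∀ (u : ℝ → ℝ → ℂ) (w : ℝ → ℝ → ℝ → ℂ),
        IsHeatSolution T u →
        IsSchrodingerisedSolution T (fun p => Real.exp (-|p|)) (u T) w →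
        sobolevNorm s (u 0) < ⊤ →
        (tailNorm s ηmax (u 0) / ENNReal.ofReal ε) ^ (1 / s) ≤ ENNReal.ofReal ηmax →
        -- regularity of the whole-line solution at time zero
        mixedNorm s (w 0) < ⊤ ∧
        -- comparison of the periodic and the whole-line problem
        (3 * ηmax ^ 2 * T < π * L →
          ∀ W : ℝ → ℝ → ℝ → ℂ, IsPeriodicSolution T L (u T) W →
          (∫⁻ t in Icc 0 T, seminormH1Sq (fun x => W t x (-(π * L)) - w t x (-(π * L))))
              ≤ ENNReal.ofReal (5 / 2 * Real.exp (-(2 * (π * L - 3 * ηmax ^ 2 * T))))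
                  * sobolevNorm 0 (u T) ^ 2
                + ENNReal.ofReal (Real.exp (-(3 * ηmax ^ 2 * T)) * ε ^ 2) ∧
          boxL2Norm (-(π * L)) (π * L) (fun x p => w 0 x p - W 0 x p)
              ≤ ENNReal.ofReal C *
                (ENNReal.ofReal (Real.exp (-(π * L - 3 * ηmax ^ 2 * T)))
                    * sobolevNorm 0 (u T)
                  + ENNReal.ofReal (Real.exp (-(3 / 2 * ηmax ^ 2 * T)) * ε))) ∧
        -- error of the recovered numerical solution
        (ENNReal.ofReal (Real.exp (-(π * L - 4.5 * ηmax ^ 2 * T))) * sobolevNorm 0 (u T)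
            ≤ ENNReal.ofReal (K * ε) →
          ∀ (n m : ℕ), 0 < n → Even n → 0 < m → Even m →
          ∀ wh : ℝ → Fin n × Fin m → ℂ, IsDiscreteSolution T L n m (u T) wh →
          ∀ ℓ : ℝ, ℓ ≤ min (π * L - ηmax ^ 2 * T) (1 / 2 * ηmax ^ 2 * T) →
            boxL2Norm (ηmax ^ 2 * T) (ηmax ^ 2 * T + ℓ)
                (fun x p => u 0 x - (Real.exp p : ℂ) * reconstruct L n m (wh 0) x p)
              ≤ ENNReal.ofReal C *
                (ENNReal.ofReal ((2 * π * L / n + (2 * π / m) ^ s)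
                      * Real.exp (ηmax ^ 2 * T + ℓ)) * mixedNorm s (w 0)
                  + ENNReal.ofReal ((1 + √ℓ) * ε)) ∧
            ((∀ k : ℤ, ηmax < |(k : ℝ)| → coeff (u 0) k = 0) →
              boxL2Norm (ηmax ^ 2 * T) (ηmax ^ 2 * T + ℓ)
                  (fun x p => u 0 x - (Real.exp p : ℂ) * reconstruct L n m (wh 0) x p)
                ≤ ENNReal.ofReal C *
                  (ENNReal.ofReal ((2 * π * L / n + (2 * π / m) ^ s)
                        * Real.exp (ηmax ^ 2 * T + ℓ)) * mixedNorm s (w 0)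
                    + ENNReal.ofReal ε))) := by
  have hC2 := two_le_errorConst s K
  refine ⟨errorConst s K, by linarith, ?_⟩
  intro T L η ε hT hL hη hε u w hu hw h0 h
  have hs0 : 0 < s := by linarith
  refine ⟨mixedNorm_lt_top hT hu hw h0, fun hL3 W hW => ⟨?_, ?_⟩, ?_⟩
  · exact lintegral_seminormH1Sq_boundary_le hT hL hs0 hη hε hu hw hW h hL3
  · refine (boxL2Norm_sub_le hT hL hs0 hη hε hu hw hW h hL3).trans ?_
    gcongr
    simpa using ENNReal.ofReal_le_ofReal hC2
  · intro hKε n m hn hne hm hme wh hwh ℓ hℓ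
    have : NeZero n := ⟨hn.ne'⟩
    have : NeZero m := ⟨hm.ne'⟩
    rcases le_or_gt ℓ 0 with hℓ0 | hℓ0
    · rw [boxL2Norm_eq_zero_of_le (by linarith)]
      exact ⟨zero_le, fun _ => zero_le⟩
    have key := boxL2Norm_recovered_sq_le hT hL hs hη hε hK hℓ0.le (hℓ.trans (min_le_left _ _))
      ((hℓ.trans (min_le_right _ _)).trans_eq (by ring)) hu hw h0 h hKε hne hme hwh
    refine ⟨le_ofReal_mul_add_of_sq_le (by linarith) key ?_, fun hres =>
      le_ofReal_mul_add_of_sq_le (by linarith) key ?_⟩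
    · refine (add_le_add_left (mul_le_mul_right (tsum_highFreq_le hs0 hη hε h) _) _).trans ?_
      rw [← ENNReal.ofReal_mul hℓ0.le, ← ENNReal.ofReal_add (by positivity) (by positivity),
        ← ENNReal.ofReal_pow (by positivity)]
      refine ENNReal.ofReal_le_ofReal ?_
      have h1 := Real.sq_sqrt hℓ0.le
      have h2 : 0 ≤ √ℓ * ε ^ 2 := by positivity
      nlinarith
    · have htail : ∑' k : ℤ, (if η < |(k : ℝ)| then ‖coeff (u 0) k‖ₑ ^ 2 else 0) = 0 := by
        refine ENNReal.tsum_eq_zero.2 fun k => ?_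
        split_ifs with hk
        · simp [hres k hk]
        · rfl
      rw [htail, mul_zero, zero_add, ENNReal.ofReal_pow hε.le]
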